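/- **Setting.** Consider the Hammerstein system $$y_{k+1}=a_1y_k+\cdots+a_py_{k+1-p}+b_1f(u_k)+\cdots+b_qf(u_{k+1-q})+w_{k+1},\qquad f(u)=\sum_{j=1}^s d_jg_j(u),$$ with measurable basis functions $g_j:\mathbb R\to\mathbb R$ and arbitrary initial values. Let $r=p+qs$, $$\varphi_k=[y_k\dots y_{k+1-p}\ g_1(u_k)\dots g_s(u_k)\ \dots\ g_1(u_{k+1-q})\dots g_s(u_{k+1-q})]^T\in\mathbb R^{r},$$ so that $y_{k+1}=\theta^T\varphi_k+w_{k+1}$ with $\theta=[a_1\dots a_p\ (b_1d_1)\dots(b_1d_s)\ \dots\ (b_qd_1)\dots(b_qd_s)]^T$. Let $\{\mathcal F_k\}$ be a filtration such that $y_j,u_j,w_j$ are $\mathcal F_k$-measurable for $j\le k$. **Algorithm.** Let $\lambda_{\max}(N),\lambda_{\min}(N)$ be the extreme eigenvalues of $\sum_{k=1}^N\varphi_k\varphi_k^T$, let $\theta_{N+1}=\big(\sum_{k=1}^N\varphi_k\varphi_k^T\big)^{-1}\sum_{k=1}^N\varphi_ky_{k+1}$, and $$\widehat\theta_{N+1}(l)=\theta_{N+1}(l)+\mathrm{sgn}(\theta_{N+1}(l))\sqrt{\frac{\log\lambda_{\max}(N)}{\lambda_{\min}(N)}},\qquad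 \mathrm{sgn}(x)=1\ (x\ge 0),\ \ -1\ (x<0).$$ Let $\beta_{N+1}$ be the minimiser over $\beta\in\mathbb R^r$ of $$J_{N+1}(\beta)=\sum_{k=1}^N(y_{k+1}-\beta^T\varphi_k)^2+\lambda_N\sum_{l=1}^r\frac{|\beta(l)|}{|\widehat\theta_{N+1}(l)|}.$$ Write $(b_id_l)_{N+1}$ for the entry of $\beta_{N+1}$ in the position of $b_id_l$, and set $$B^*=\{l: d_l=0\},\qquad B^*_{N+1}=\{l:(b_1d_l)_{N+1}=\cdots=(b_qd_l)_{N+1}=0\}.$$ **Assumptions.** 1. $\mathbb E[w_{k+1}\mid\mathcal F_k]=0$ for $k\ge1$, and $\sup_{k\ge 1}\mathbb E[|w_{k+1}|^\gamma\mid\mathcal F_k]<\infty$ a.s. for some $\gamma>2$. 2. $A(z)=1-a_1z-\cdots-a_pz^p\ne0$ for all complex $|z|\le1$, and $b_1^2+\cdots+b_q^2\neq0$. 3. $1,g_1,\dots,g_s$ are linearly independent over some interval $[x_0,x_1]$, $x_0<x_1$, functions equal Lebesgue-almost everywhere on $[x_0,x_1]$ being identified. 4. $\{u_k\}_{k\ge1}$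 is i.i.d. with a density that is positive and continuous on $[x_0,x_1]$, $0<\mathbb E g_i(u_k)^2<\infty$ for $i=1,\dots,s$, and the sequences $\{u_k\}_{k\ge1}$ and $\{w_k\}_{k\ge1}$ are independent. 5. (Nondegeneracy.) Either $\liminf_{N\to\infty}\frac1N\sum_{k=1}^Nw_k^2>0$ a.s., or else $A(z)$ and $B(z)=b_1+b_2z+\cdots+b_qz^{q-1}$ are coprime, the coefficient of $z^p$ in $A(z)$ or the coefficient $b_q$ is nonzero, and $(d_1,\dots,d_s)\ne0$. **Proposition 2.** Let $\lambda_N=N^{\frac12+\epsilon}$ with fixed $\epsilon\in(0,\frac12)$. Under these assumptions there is a set $\Omega_0$ with $\mathbb P(\Omega_0)=1$ such that for every $\omega\in\Omega_0$ there is an integer $N_0(\omega)$ such that for all $N\ge N_0(\omega)$ the algorithm is well defined (the matrix $\sum_{k=1}^N\varphi_k\varphi_k^T$ is invertible, $\widehat\theta_{N+1}(l)\ne0$ for all $l$, and $J_{N+1}$ has exactly one minimiser) and $$B^*_{N+1}=B^*.$$ -/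

import Mathlib

open MeasureTheory ProbabilityTheory Filter Matrix

/-! ### The sparse identification algorithm for a linear regression

`φ k` is the regressor at time `k`, `z k` the output paired with it (the output at time `k + 1`);
the data available at step `N` are `(φ k, z k)` for `k = 1, …, N`. -/

section Algorithm

variable {ι : Type*}

/-- The information matrix `∑_{k=1}^N φ_k φ_kᵀ`. -/
def gramMatrix (φ : ℕ → ι → ℝ) (N : ℕ) : Matrix ι ι ℝ :=
  ∑ k ∈ Finset.Icc 1 N, vecMulVec (φ k) (φ k)

theorem gramMatrix_isHermitian (φ : ℕ → ι → ℝ) (N : ℕ) : (gramMatrix φ N).IsHermitian := by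
  ext i j
  simp [gramMatrix, Matrix.sum_apply, vecMulVec_apply, mul_comm]

variable [Fintype ι] [DecidableEq ι]

/-- `λ_max(N)`, the largest eigenvalue of the information matrix. -/
noncomputable def lamMax (φ : ℕ → ι → ℝ) (N : ℕ) : ℝ :=
  ⨆ i, (gramMatrix_isHermitian φ N).eigenvalues i

/-- `λ_min(N)`, the smallest eigenvalue of the information matrix. -/
noncomputable def lamMin (φ : ℕ → ι → ℝ) (N : ℕ) : ℝ :=
  ⨅ i, (gramMatrix_isHermitian φ N).eigenvalues i

/-- The least-squares estimate `(∑ φ_k φ_kᵀ)⁻¹ ∑ φ_k y_{k+1}` from the data `k = 1, …, N`. -/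
noncomputable def lsEstimate (φ : ℕ → ι → ℝ) (z : ℕ → ℝ) (N : ℕ) : ι → ℝ :=
  (gramMatrix φ N)⁻¹ *ᵥ ∑ k ∈ Finset.Icc 1 N, z k • φ k

/-- The sign convention `sgn x = 1` for `x ≥ 0` and `sgn x = -1` for `x < 0`. -/
noncomputable def sgnPlus (x : ℝ) : ℝ := if 0 ≤ x then 1 else -1

/-- The modified least-squares estimate
`θ(j) + sgn(θ(j)) √(log λ_max(N) / λ_min(N))`. -/
noncomputable def modifiedEstimate (φ : ℕ → ι → ℝ) (z : ℕ → ℝ) (N : ℕ) (j : ι) : ℝ :=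
  lsEstimate φ z N j +
    sgnPlus (lsEstimate φ z N j) * Real.sqrt (Real.log (lamMax φ N) / lamMin φ N)

/-- The convex criterion
`∑_{k=1}^N (y_{k+1} - βᵀ φ_k)² + λ_N ∑_l |β(l)| / |modified estimate (l)|`. -/
noncomputable def sparseCriterion (φ : ℕ → ι → ℝ) (z : ℕ → ℝ) (lam : ℕ → ℝ) (N : ℕ)
    (β : ι → ℝ) : ℝ :=
  ∑ k ∈ Finset.Icc 1 N, (z k - β ⬝ᵥ φ k) ^ 2 +
    lam N * ∑ l, 1 / |modifiedEstimate φ z N l| * |β l|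

/-- `β` is a (global) minimiser of the convex criterion. -/
def IsSparseEstimate (φ : ℕ → ι → ℝ) (z : ℕ → ℝ) (lam : ℕ → ℝ) (N : ℕ) (β : ι → ℝ) : Prop :=
  ∀ β' : ι → ℝ, sparseCriterion φ z lam N β ≤ sparseCriterion φ z lam N β'

/-- The algorithm is well defined at step `N`: the information matrix is invertible, no weight in
the criterion has a vanishing denominator, and the criterion has exactly one minimiser. -/
def SparseAlgorithmWellDefined (φ : ℕ → ι → ℝ) (z : ℕ → ℝ) (lam : ℕ → ℝ) (N : ℕ) : Prop :=
  IsUnit (gramMatrix φ N).det ∧ (∀ l, modifiedEstimate φ z N l ≠ 0) ∧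
    ∃! β : ι → ℝ, IsSparseEstimate φ z lam N β

end Algorithm

/-! ### Hammerstein systems -/

section Hammerstein

variable {p q s : ℕ}

/-- `A(z) = 1 - a_1 z - ⋯ - a_p z^p`. -/
noncomputable def arPoly (a : Fin p → ℝ) : Polynomial ℝ :=
  1 - ∑ i : Fin p, Polynomial.C (a i) * Polynomial.X ^ ((i : ℕ) + 1)

/-- `B(z) = b_1 + b_2 z + ⋯ + b_q z^(q-1)`. -/
noncomputable def inputPoly (b : Fin q → ℝ) : Polynomial ℝ :=
  ∑ i : Fin q, Polynomial.C (b i) * Polynomial.X ^ (i : ℕ)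

/-- The Hammerstein equations, along one sample path:
`y_{k+1} = a_1 y_k + ⋯ + a_p y_{k+1-p} + b_1 f(u_k) + ⋯ + b_q f(u_{k+1-q}) + w_{k+1}` for `k ≥ 1`,
with `f = ∑_j d_j g_j`. The values `y_j`, `u_j` at times `j` that precede the equations
are arbitrary initial values. -/
def IsHammersteinPath (a : Fin p → ℝ) (b : Fin q → ℝ) (d : Fin s → ℝ) (g : Fin s → ℝ → ℝ)
    (y u : ℤ → ℝ) (w : ℕ → ℝ) : Prop :=
  ∀ k : ℕ, 1 ≤ k →
    y ((k : ℤ) + 1) = ∑ i : Fin p, a i * y ((k : ℤ) - (i : ℤ))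
      + ∑ i : Fin q, b i * ∑ j : Fin s, d j * g j (u ((k : ℤ) - (i : ℤ))) + w (k + 1)

/-- The over-parametrised regressor
`[y_k, …, y_{k+1-p}, g_1(u_k), …, g_s(u_k), …, g_1(u_{k+1-q}), …, g_s(u_{k+1-q})]`:
the entry `inl i` goes with `a_i`, the entry `inr (i, j)` with the product `b_i d_j`. -/
def hammersteinRegressor (p q : ℕ) (g : Fin s → ℝ → ℝ) (y u : ℤ → ℝ) (k : ℕ) :
    Fin p ⊕ (Fin q × Fin s) → ℝ :=
  Sum.elim (fun i => y ((k : ℤ) - (i : ℤ))) (fun ij => g ij.2 (u ((k : ℤ) - (ij.1 : ℤ))))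

/-- The output `y_{k+1}` paired with the regressor at time `k`. -/
def nextOutput (y : ℤ → ℝ) (k : ℕ) : ℝ := y ((k : ℤ) + 1)

/-- The indices `l` for which the column `[(b_1 d_l), …, (b_q d_l)]ᵀ` of an over-parametrised
parameter vector vanishes. -/
def zeroColumns (β : Fin p ⊕ (Fin q × Fin s) → ℝ) : Set (Fin s) :=
  {l | ∀ i : Fin q, β (Sum.inr (i, l)) = 0}

/-- `A` is stable (no zero in the closed unit disc) and `b_1² + ⋯ + b_q² ≠ 0`. -/
def StableARX (a : Fin p → ℝ) (b : Fin q → ℝ) : Prop :=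
  (∀ z : ℂ, ‖z‖ ≤ 1 → Polynomial.aeval z (arPoly a) ≠ 0) ∧ ∑ i, b i ^ 2 ≠ 0

/-- `1, g_1, …, g_s` are linearly independent over `[lo, hi]`, functions that agree
Lebesgue-almost everywhere being identified. For functions that are continuous on `[lo, hi]`,
`lo < hi`, this is linear independence on `[lo, hi]`. -/
def BasisIndependentOn (g : Fin s → ℝ → ℝ) (lo hi : ℝ) : Prop :=
  ∀ (c₀ : ℝ) (c : Fin s → ℝ),
    (∀ᵐ x ∂(volume.restrict (Set.Icc lo hi)), c₀ + ∑ j, c j * g j x = 0) → c₀ = 0 ∧ c = 0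

variable {Ω : Type*} {mΩ : MeasurableSpace Ω}

/-- `{w_k, ℱ_k}` is a martingale difference sequence, `E[w_{k+1} | ℱ_k] = 0` for `k ≥ 1`, and
`sup_k E[|w_{k+1}|^γ | ℱ_k] < ∞` almost surely for some `γ > 2`. -/
def MartingaleDifferenceNoise (P : Measure Ω) (ℱ : Filtration ℕ mΩ) (w : ℕ → Ω → ℝ) : Prop :=
  (∀ k, 1 ≤ k → Measurable[ℱ k] (w k)) ∧
  (∀ k, 1 ≤ k → Integrable (w (k + 1)) P ∧ P[w (k + 1) | ℱ k] =ᵐ[P] 0) ∧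
  ∃ γ : ℝ, 2 < γ ∧ ∀ᵐ ω ∂P,
    ⨆ k : ℕ, ⨆ _ : 1 ≤ k,
      condLExp (ℱ k) P (fun ω' => ENNReal.ofReal (|w (k + 1) ω'| ^ γ)) ω < ⊤

/-- `{u_k}_{k ≥ 1}` is i.i.d. with a density that is positive and continuous on `[lo, hi]`,
`0 < E g_i(u_k)² < ∞` for all `i`, and `{u_k}_{k ≥ 1}` is independent of `{w_k}_{k ≥ 1}`. -/
def IIDInput (P : Measure Ω) (g : Fin s → ℝ → ℝ) (lo hi : ℝ) (u : ℤ → Ω → ℝ)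
    (w : ℕ → Ω → ℝ) : Prop :=
  iIndepFun (fun (k : ℕ) ω => u ((k : ℤ) + 1) ω) P ∧
  (∃ dens : ℝ → ℝ, Measurable dens ∧ (∀ x, 0 ≤ dens x) ∧ ContinuousOn dens (Set.Icc lo hi) ∧
    (∀ x ∈ Set.Icc lo hi, 0 < dens x) ∧
    ∀ k : ℤ, 1 ≤ k →
      P.map (u k) = volume.withDensity (fun x => ENNReal.ofReal (dens x))) ∧
  (∀ i, ∀ k : ℤ, 1 ≤ k →
    Integrable (fun ω => g i (u k ω) ^ 2) P ∧ 0 < ∫ ω, g i (u k ω) ^ 2 ∂P) ∧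
  IndepFun (fun ω (k : ℕ) => u ((k : ℤ) + 1) ω) (fun ω (k : ℕ) => w (k + 1) ω) P

/-- The noise does not die out: almost surely `liminf (1/N) ∑_{k=1}^N w_k² > 0`. -/
def PersistentNoise (P : Measure Ω) (w : ℕ → Ω → ℝ) : Prop :=
  ∀ᵐ ω ∂P, ∃ c : ℝ, 0 < c ∧ ∀ᶠ N : ℕ in atTop, c * N ≤ ∑ k ∈ Finset.Icc 1 N, w k ω ^ 2

/-- The noise-free part of the system has no redundancy: `A` and `B` have no common factor,
`a_p ≠ 0` or `b_q ≠ 0`, and `f` is not the zero combination. For `p = 0` the second condition holds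
automatically, since the coefficient of degree `0` of `A` is `1`. -/
def MinimalSystem (a : Fin p → ℝ) (b : Fin q → ℝ) (d : Fin s → ℝ) : Prop :=
  IsCoprime (arPoly a) (inputPoly b) ∧
    ((arPoly a).coeff p ≠ 0 ∨ (Polynomial.X * inputPoly b).coeff q ≠ 0) ∧ d ≠ 0

end Hammerstein

/-!
Applying `A(S)`, with `S` the backshift, to the scalar signal `xᵀφ_k` eliminates the outputs and
leaves a finite moving average of the noise and of the centered signals `g_j(u_k)`. These are white
in time average, by the martingale convergence theorem and the strong law of large numbers, and
nondegeneracy makes the limiting second moment positive for every `x ≠ 0`. Hence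
`λ_min(N) ≥ c N` eventually.

Stability gives `∑ ‖φ_k‖² = O(N^(1+2δ))`, and martingale convergence bounds the score
`∑ w_{k+1} φ_k` by `O(N^(1/2+δ))`, for every `δ > 0`. So the modified estimate is within
`O(N^(δ-1/2))` of `θ`, and its offset `√(log λ_max / λ_min)` keeps it away from `0`. The penalty
`λ_N / |θ̂(l)|` is therefore `O(λ_N) = o(N)` where `θ(l) ≠ 0`, too small to destroy consistency,
whereas where `θ(l) = 0` it is at least of order `λ_N N^(1/2-δ)`, which exceeds the gradient
`O(N^(1/2+3δ))` of the quadratic part and forces `β(l) = 0`.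
-/

section LinearRegression

variable {ι : Type*} [Fintype ι]

theorem abs_dotProduct_le_card_mul_norm_mul_norm (x v : ι → ℝ) :
    |x ⬝ᵥ v| ≤ Fintype.card ι * ‖x‖ * ‖v‖ := by
  calc |x ⬝ᵥ v| ≤ ∑ l, |x l * v l| := Finset.abs_sum_le_sum_abs _ _
    _ ≤ ∑ _l : ι, ‖x‖ * ‖v‖ := Finset.sum_le_sum fun l _ => by
        rw [abs_mul]
        exact mul_le_mul (norm_le_pi_norm x l) (norm_le_pi_norm v l) (abs_nonneg _) (norm_nonneg _)
    _ = Fintype.card ι * ‖x‖ * ‖v‖ := by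
        rw [Finset.sum_const, Finset.card_univ, nsmul_eq_mul, mul_assoc]

theorem norm_sq_le_dotProduct_self (x : ι → ℝ) : ‖x‖ ^ 2 ≤ x ⬝ᵥ x := by
  have hx : 0 ≤ x ⬝ᵥ x := by simpa only [star_trivial] using dotProduct_self_star_nonneg x
  refine (Real.le_sqrt (norm_nonneg x) hx).1 ?_
  refine (pi_norm_le_iff_of_nonneg (Real.sqrt_nonneg _)).2 fun l => Real.le_sqrt_of_sq_le ?_
  rw [Real.norm_eq_abs, sq_abs, pow_two]
  exact Finset.single_le_sum (f := fun l => x l * x l) (fun l _ => mul_self_nonneg (x l))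
    (Finset.mem_univ l)

/-- The information matrix of the regressors at times `1, …, N` is at least `κ` times the identity,
stated through quadratic forms. -/
def IsExciting (φ : ℕ → ι → ℝ) (N : ℕ) (κ : ℝ) : Prop :=
  ∀ x : ι → ℝ, κ * (x ⬝ᵥ x) ≤ ∑ k ∈ Finset.Icc 1 N, (x ⬝ᵥ φ k) ^ 2

/-- The correlation `∑_{k=1}^N ν_k φ_k` between the regressors and the noise; all estimation errors
are measured against it. -/
def noiseScore (φ : ℕ → ι → ℝ) (ν : ℕ → ℝ) (N : ℕ) : ι → ℝ :=
  ∑ k ∈ Finset.Icc 1 N, ν k • φ k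

theorem gramMatrix_mulVec (φ : ℕ → ι → ℝ) (N : ℕ) (x : ι → ℝ) :
    gramMatrix φ N *ᵥ x = ∑ k ∈ Finset.Icc 1 N, (x ⬝ᵥ φ k) • φ k := by
  rw [gramMatrix, Matrix.sum_mulVec]
  refine Finset.sum_congr rfl fun k _ => ?_
  ext i
  simp [vecMulVec_mulVec, dotProduct_comm, mul_comm]

theorem dotProduct_gramMatrix_mulVec (φ : ℕ → ι → ℝ) (N : ℕ) (x : ι → ℝ) :
    x ⬝ᵥ (gramMatrix φ N *ᵥ x) = ∑ k ∈ Finset.Icc 1 N, (x ⬝ᵥ φ k) ^ 2 := by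
  rw [gramMatrix_mulVec, dotProduct_sum]
  simp only [dotProduct_smul, smul_eq_mul, pow_two]

theorem trace_gramMatrix (φ : ℕ → ι → ℝ) (N : ℕ) :
    (gramMatrix φ N).trace = ∑ k ∈ Finset.Icc 1 N, φ k ⬝ᵥ φ k := by
  rw [gramMatrix, Matrix.trace_sum]
  exact Finset.sum_congr rfl fun k _ => Matrix.trace_vecMulVec (φ k) (φ k)

theorem isExciting_zero (φ : ℕ → ι → ℝ) (N : ℕ) : IsExciting φ N 0 := fun x => by
  rw [zero_mul]
  exact Finset.sum_nonneg fun k _ => sq_nonneg (x ⬝ᵥ φ k)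

variable {φ : ℕ → ι → ℝ} {N : ℕ} {κ : ℝ}

theorem IsExciting.norm_le {x : ι → ℝ} {K : ℝ} (h : IsExciting φ N κ) (hκ : 0 < κ) (hK : 0 ≤ K)
    (hx : ∑ k ∈ Finset.Icc 1 N, (x ⬝ᵥ φ k) ^ 2 ≤ K * ‖x‖) : ‖x‖ ≤ K / κ := by
  rcases (norm_nonneg x).eq_or_lt with hx0 | hx0
  · rw [← hx0]; positivity
  · rw [le_div_iff₀ hκ]
    refine le_of_mul_le_mul_right ?_ hx0
    calc ‖x‖ * κ * ‖x‖ = κ * ‖x‖ ^ 2 := by ring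
      _ ≤ κ * (x ⬝ᵥ x) := by gcongr; exact norm_sq_le_dotProduct_self x
      _ ≤ K * ‖x‖ := (h x).trans hx

theorem IsExciting.sum_sq_pos {x : ι → ℝ} (h : IsExciting φ N κ) (hκ : 0 < κ) (hx : x ≠ 0) :
    0 < ∑ k ∈ Finset.Icc 1 N, (x ⬝ᵥ φ k) ^ 2 :=
  (mul_pos hκ (dotProduct_self_star_pos_iff.2 hx)).trans_le (h x)

theorem IsExciting.posDef_gramMatrix (h : IsExciting φ N κ) (hκ : 0 < κ) :
    (gramMatrix φ N).PosDef := by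
  refine Matrix.PosDef.of_dotProduct_mulVec_pos (gramMatrix_isHermitian φ N) fun x hx => ?_
  rw [star_trivial, dotProduct_gramMatrix_mulVec]
  exact h.sum_sq_pos hκ hx

section Eigenvalues

variable [DecidableEq ι]

theorem IsExciting.le_eigenvalues (h : IsExciting φ N κ) (i : ι) :
    κ ≤ (gramMatrix_isHermitian φ N).eigenvalues i := by
  rw [Matrix.IsHermitian.eigenvalues_eq, star_trivial, dotProduct_gramMatrix_mulVec, 
    RCLike.re_to_real]
  have hnorm := (gramMatrix_isHermitian φ N).eigenvectorBasis.orthonormal.1 i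
  rw [EuclideanSpace.norm_eq, Real.sqrt_eq_one] at hnorm
  refine le_of_eq_of_le ?_ (h _)
  simp only [Real.norm_eq_abs, sq_abs] at hnorm
  simp only [pow_two] at hnorm
  rw [dotProduct, hnorm, mul_one]

theorem IsExciting.le_lamMin [Nonempty ι] (h : IsExciting φ N κ) : κ ≤ lamMin φ N :=
  le_ciInf h.le_eigenvalues

theorem lamMin_le_lamMax [Nonempty ι] : lamMin φ N ≤ lamMax φ N :=
  ciInf_le_ciSup (Set.finite_range _).bddBelow (Set.finite_range _).bddAbove

theorem lamMax_le_sum_dotProduct_self [Nonempty ι] :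
    lamMax φ N ≤ ∑ k ∈ Finset.Icc 1 N, φ k ⬝ᵥ φ k := by
  refine ciSup_le fun i => ?_
  rw [← trace_gramMatrix, (gramMatrix_isHermitian φ N).trace_eq_sum_eigenvalues]
  exact Finset.single_le_sum (fun j _ => (isExciting_zero φ N).le_eigenvalues j)
    (Finset.mem_univ i)

theorem gramMatrix_mulVec_lsEstimate_sub {z ν : ℕ → ℝ} {θ : ι → ℝ}
    (hdet : IsUnit (gramMatrix φ N).det) (hz : ∀ k, 1 ≤ k → z k = θ ⬝ᵥ φ k + ν k) :
    gramMatrix φ N *ᵥ (lsEstimate φ z N - θ) = noiseScore φ ν N := by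
  have hdata : ∑ k ∈ Finset.Icc 1 N, z k • φ k = gramMatrix φ N *ᵥ θ + noiseScore φ ν N := by
    rw [gramMatrix_mulVec, noiseScore, ← Finset.sum_add_distrib]
    refine Finset.sum_congr rfl fun k hk => ?_
    rw [hz k (Finset.mem_Icc.1 hk).1, add_smul]
  rw [Matrix.mulVec_sub, lsEstimate, Matrix.mulVec_mulVec, Matrix.mul_nonsing_inv _ hdet,
    Matrix.one_mulVec, hdata, add_sub_cancel_left]

theorem IsExciting.norm_lsEstimate_sub_le {z ν : ℕ → ℝ} {θ : ι → ℝ} (h : IsExciting φ N κ)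
    (hκ : 0 < κ) (hz : ∀ k, 1 ≤ k → z k = θ ⬝ᵥ φ k + ν k) :
    ‖lsEstimate φ z N - θ‖ ≤ Fintype.card ι * ‖noiseScore φ ν N‖ / κ := by
  have hdet : IsUnit (gramMatrix φ N).det := (h.posDef_gramMatrix hκ).det_pos.ne'.isUnit
  refine h.norm_le hκ (by positivity) ?_
  rw [← dotProduct_gramMatrix_mulVec, gramMatrix_mulVec_lsEstimate_sub hdet hz]
  refine (le_abs_self _).trans ((abs_dotProduct_le_card_mul_norm_mul_norm _ _).trans_eq ?_)
  ring

theorem abs_modifiedEstimate (z : ℕ → ℝ) (l : ι) :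
    |modifiedEstimate φ z N l| =
      |lsEstimate φ z N l| + √(Real.log (lamMax φ N) / lamMin φ N) := by
  have hs := Real.sqrt_nonneg (Real.log (lamMax φ N) / lamMin φ N)
  unfold modifiedEstimate sgnPlus
  split_ifs with h
  · rw [one_mul, abs_of_nonneg (add_nonneg h hs), abs_of_nonneg h]
  · rw [abs_of_neg (not_le.1 h), abs_of_neg (by linarith)]
    ring

end Eigenvalues

end LinearRegression

section WeightedLasso

variable {ι : Type*} [Fintype ι]

/-- The least-squares criterion with the weighted `ℓ¹` penalty `∑_l ω_l |β_l|`, the form of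
`sparseCriterion` in which the weights are arbitrary. -/
def weightedLasso (φ : ℕ → ι → ℝ) (z : ℕ → ℝ) (ω : ι → ℝ) (N : ℕ) (β : ι → ℝ) : ℝ :=
  ∑ k ∈ Finset.Icc 1 N, (z k - β ⬝ᵥ φ k) ^ 2 + ∑ l, ω l * |β l|

theorem isSparseEstimate_iff_isMinOn_weightedLasso [DecidableEq ι] {φ : ℕ → ι → ℝ} {z lam : ℕ → ℝ}
    {N : ℕ} {β : ι → ℝ} :
    IsSparseEstimate φ z lam N β ↔
      IsMinOn (weightedLasso φ z (fun l => lam N / |modifiedEstimate φ z N l|) N) Set.univ β := by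
  have hcriterion : sparseCriterion φ z lam N =
      weightedLasso φ z (fun l => lam N / |modifiedEstimate φ z N l|) N := by
    funext β
    simp only [sparseCriterion, weightedLasso, Finset.mul_sum, ← mul_assoc, mul_one_div]
  rw [isMinOn_univ_iff, ← hcriterion, IsSparseEstimate]

variable {φ : ℕ → ι → ℝ} {z ν : ℕ → ℝ} {ω θ β : ι → ℝ} {N : ℕ} {κ : ℝ}

theorem continuous_weightedLasso : Continuous (weightedLasso φ z ω N) := by
  unfold weightedLasso dotProduct
  fun_prop

theorem IsExciting.le_weightedLasso (h : IsExciting φ N κ) (hκ : 0 ≤ κ) (hω : ∀ l, 0 ≤ ω l)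
    (β : ι → ℝ) :
    κ / 2 * ‖β‖ ^ 2 + -∑ k ∈ Finset.Icc 1 N, z k ^ 2 ≤ weightedLasso φ z ω N β := by
  have hpenalty : 0 ≤ ∑ l, ω l * |β l| :=
    Finset.sum_nonneg fun l _ => mul_nonneg (hω l) (abs_nonneg _)
  have hloss : κ * ‖β‖ ^ 2 ≤
      2 * ∑ k ∈ Finset.Icc 1 N, (z k - β ⬝ᵥ φ k) ^ 2 + 2 * ∑ k ∈ Finset.Icc 1 N, z k ^ 2 := by
    calc κ * ‖β‖ ^ 2 ≤ κ * (β ⬝ᵥ β) := by gcongr; exact norm_sq_le_dotProduct_self β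
      _ ≤ ∑ k ∈ Finset.Icc 1 N, (β ⬝ᵥ φ k) ^ 2 := h β
      _ ≤ ∑ k ∈ Finset.Icc 1 N, (2 * (z k - β ⬝ᵥ φ k) ^ 2 + 2 * z k ^ 2) :=
          Finset.sum_le_sum fun k _ => by nlinarith [sq_nonneg (2 * z k - β ⬝ᵥ φ k)]
      _ = _ := by rw [Finset.sum_add_distrib, ← Finset.mul_sum, ← Finset.mul_sum]
  unfold weightedLasso
  linarith

theorem IsExciting.tendsto_weightedLasso_cocompact (h : IsExciting φ N κ) (hκ : 0 < κ)
    (hω : ∀ l, 0 ≤ ω l) :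
    Tendsto (weightedLasso φ z ω N) (cocompact (ι → ℝ)) atTop := by
  have hsq : Tendsto (fun β : ι → ℝ => ‖β‖ ^ 2) (cocompact (ι → ℝ)) atTop :=
    (tendsto_pow_atTop two_ne_zero).comp (tendsto_norm_cocompact_atTop (E := ι → ℝ))
  exact tendsto_atTop_mono (h.le_weightedLasso hκ.le hω)
    (tendsto_atTop_add_const_right _ _ (hsq.const_mul_atTop (half_pos hκ)))

theorem IsExciting.strictConvexOn_weightedLasso (h : IsExciting φ N κ) (hκ : 0 < κ)
    (hω : ∀ l, 0 ≤ ω l) : StrictConvexOn ℝ Set.univ (weightedLasso φ z ω N) := by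
  refine ⟨convex_univ, fun β _ β' _ hne s t hs ht hst => ?_⟩
  have hpos := mul_pos (mul_pos hs ht) (h.sum_sq_pos hκ (sub_ne_zero.2 hne))
  have hloss : ∑ k ∈ Finset.Icc 1 N, (z k - (s • β + t • β') ⬝ᵥ φ k) ^ 2 =
      s * ∑ k ∈ Finset.Icc 1 N, (z k - β ⬝ᵥ φ k) ^ 2 +
        t * ∑ k ∈ Finset.Icc 1 N, (z k - β' ⬝ᵥ φ k) ^ 2 -
        s * t * ∑ k ∈ Finset.Icc 1 N, ((β - β') ⬝ᵥ φ k) ^ 2 := by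
    rw [Finset.mul_sum, Finset.mul_sum, Finset.mul_sum, ← Finset.sum_add_distrib,
      ← Finset.sum_sub_distrib]
    refine Finset.sum_congr rfl fun k _ => ?_
    rw [add_dotProduct, smul_dotProduct, smul_dotProduct, sub_dotProduct, smul_eq_mul, smul_eq_mul,
      eq_sub_of_add_eq' hst]
    ring
  have hpenalty : ∑ l, ω l * |(s • β + t • β') l| ≤
      s * ∑ l, ω l * |β l| + t * ∑ l, ω l * |β' l| := by
    rw [Finset.mul_sum, Finset.mul_sum, ← Finset.sum_add_distrib]
    refine Finset.sum_le_sum fun l _ => ?_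
    have habs : |(s • β + t • β') l| ≤ s * |β l| + t * |β' l| := by
      simpa [abs_mul, abs_of_pos hs, abs_of_pos ht] using abs_add_le (s * β l) (t * β' l)
    linarith [mul_le_mul_of_nonneg_left habs (hω l)]
  simp only [weightedLasso, smul_eq_mul]
  linarith

theorem IsExciting.existsUnique_isMinOn_weightedLasso (h : IsExciting φ N κ) (hκ : 0 < κ)
    (hω : ∀ l, 0 ≤ ω l) : ∃! β, IsMinOn (weightedLasso φ z ω N) Set.univ β := by
  obtain ⟨β, hβ⟩ := continuous_weightedLasso.exists_forall_le
    (h.tendsto_weightedLasso_cocompact (z := z) hκ hω)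
  refine ⟨β, isMinOn_univ_iff.2 hβ, fun β' hβ' => ?_⟩
  exact (h.strictConvexOn_weightedLasso hκ hω).eq_of_isMinOn hβ' (isMinOn_univ_iff.2 hβ)
    (Set.mem_univ _) (Set.mem_univ _)

theorem dotProduct_noiseScore (φ : ℕ → ι → ℝ) (ν : ℕ → ℝ) (N : ℕ) (x : ι → ℝ) :
    x ⬝ᵥ noiseScore φ ν N = ∑ k ∈ Finset.Icc 1 N, ν k * (x ⬝ᵥ φ k) := by
  simp only [noiseScore, dotProduct_sum, dotProduct_smul, smul_eq_mul]

theorem sum_sq_residual_sub (hz : ∀ k, 1 ≤ k → z k = θ ⬝ᵥ φ k + ν k) (β : ι → ℝ) :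
    ∑ k ∈ Finset.Icc 1 N, (z k - θ ⬝ᵥ φ k) ^ 2 - ∑ k ∈ Finset.Icc 1 N, (z k - β ⬝ᵥ φ k) ^ 2 =
      2 * ((β - θ) ⬝ᵥ noiseScore φ ν N) - ∑ k ∈ Finset.Icc 1 N, ((β - θ) ⬝ᵥ φ k) ^ 2 := by
  rw [dotProduct_noiseScore, Finset.mul_sum, ← Finset.sum_sub_distrib, ← Finset.sum_sub_distrib]
  refine Finset.sum_congr rfl fun k hk => ?_
  rw [hz k (Finset.mem_Icc.1 hk).1, sub_dotProduct]
  ring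

theorem sum_mul_abs_sub_abs_le {W : ℝ} (hW : 0 ≤ W) (hω : ∀ l, 0 ≤ ω l)
    (hωW : ∀ l, θ l ≠ 0 → ω l ≤ W) (β : ι → ℝ) :
    ∑ l, ω l * |θ l| - ∑ l, ω l * |β l| ≤ Fintype.card ι * W * ‖β - θ‖ := by
  calc ∑ l, ω l * |θ l| - ∑ l, ω l * |β l| = ∑ l, ω l * (|θ l| - |β l|) := by
        simp only [mul_sub, Finset.sum_sub_distrib]
    _ ≤ ∑ _l : ι, W * ‖β - θ‖ := Finset.sum_le_sum fun l _ => ?_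
    _ = Fintype.card ι * W * ‖β - θ‖ := by
        rw [Finset.sum_const, Finset.card_univ, nsmul_eq_mul, mul_assoc]
  have hdiff : |θ l| - |β l| ≤ ‖β - θ‖ := by
    rw [norm_sub_rev]
    exact (abs_sub_abs_le_abs_sub _ _).trans (norm_le_pi_norm (θ - β) l)
  rcases eq_or_ne (θ l) 0 with hl | hl
  · rw [hl, abs_zero, zero_sub, mul_neg]
    exact (neg_nonpos.2 (mul_nonneg (hω l) (abs_nonneg _))).trans
      (mul_nonneg hW (norm_nonneg _))
  · exact (mul_le_mul_of_nonneg_left hdiff (hω l)).trans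
      (mul_le_mul_of_nonneg_right (hωW l hl) (norm_nonneg _))

theorem IsExciting.norm_sub_le_of_isMinOn_weightedLasso {W : ℝ} (h : IsExciting φ N κ)
    (hκ : 0 < κ) (hz : ∀ k, 1 ≤ k → z k = θ ⬝ᵥ φ k + ν k) (hW : 0 ≤ W) (hω : ∀ l, 0 ≤ ω l)
    (hωW : ∀ l, θ l ≠ 0 → ω l ≤ W) (hβ : IsMinOn (weightedLasso φ z ω N) Set.univ β) :
    ‖β - θ‖ ≤ Fintype.card ι * (2 * ‖noiseScore φ ν N‖ + W) / κ := by
  refine h.norm_le hκ (by positivity) ?_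
  have hmin : weightedLasso φ z ω N β ≤ weightedLasso φ z ω N θ := isMinOn_univ_iff.1 hβ θ
  have hloss := sum_sq_residual_sub (N := N) hz β
  have hpenalty := sum_mul_abs_sub_abs_le hW hω hωW β
  have hscore := (le_abs_self _).trans
    (abs_dotProduct_le_card_mul_norm_mul_norm (β - θ) (noiseScore φ ν N))
  unfold weightedLasso at hmin
  linarith

theorem weightedLasso_update_zero [DecidableEq ι] (β : ι → ℝ) (l : ι) :
    weightedLasso φ z ω N (Function.update β l 0) =
      weightedLasso φ z ω N β + 2 * β l * ∑ k ∈ Finset.Icc 1 N, (z k - β ⬝ᵥ φ k) * φ k l +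
        β l ^ 2 * ∑ k ∈ Finset.Icc 1 N, φ k l ^ 2 - ω l * |β l| := by
  have hupdate : Function.update β l 0 = β - Pi.single l (β l) := by
    ext j
    rcases eq_or_ne j l with rfl | hj <;> simp [*]
  have hloss : ∑ k ∈ Finset.Icc 1 N, (z k - Function.update β l 0 ⬝ᵥ φ k) ^ 2 =
      ∑ k ∈ Finset.Icc 1 N, (z k - β ⬝ᵥ φ k) ^ 2 +
        2 * β l * ∑ k ∈ Finset.Icc 1 N, (z k - β ⬝ᵥ φ k) * φ k l +
        β l ^ 2 * ∑ k ∈ Finset.Icc 1 N, φ k l ^ 2 := by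
    rw [Finset.mul_sum, Finset.mul_sum, ← Finset.sum_add_distrib, ← Finset.sum_add_distrib]
    refine Finset.sum_congr rfl fun k _ => ?_
    rw [hupdate, sub_dotProduct, single_dotProduct]
    ring
  have hpenalty : ∑ j, ω j * |Function.update β l 0 j| = ∑ j, ω j * |β j| - ω l * |β l| := by
    rw [← Finset.add_sum_erase _ _ (Finset.mem_univ l),
      ← Finset.add_sum_erase _ (fun j => ω j * |β j|) (Finset.mem_univ l),
      Function.update_self, abs_zero, mul_zero, zero_add, add_sub_cancel_left]
    exact Finset.sum_congr rfl fun j hj => by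
      rw [Function.update_of_ne (Finset.ne_of_mem_erase hj)]
  rw [weightedLasso, weightedLasso, hloss, hpenalty]
  ring

theorem sum_sq_apply_le_sum_dotProduct_self (φ : ℕ → ι → ℝ) (N : ℕ) (l : ι) :
    ∑ k ∈ Finset.Icc 1 N, φ k l ^ 2 ≤ ∑ k ∈ Finset.Icc 1 N, φ k ⬝ᵥ φ k :=
  Finset.sum_le_sum fun k _ => by
    rw [pow_two]
    exact Finset.single_le_sum (f := fun j => φ k j * φ k j) (fun j _ => mul_self_nonneg _)
      (Finset.mem_univ l)

theorem abs_sum_dotProduct_mul_apply_le (x : ι → ℝ) (l : ι) :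
    |∑ k ∈ Finset.Icc 1 N, (x ⬝ᵥ φ k) * φ k l| ≤
      Fintype.card ι * ‖x‖ * ∑ k ∈ Finset.Icc 1 N, φ k ⬝ᵥ φ k := by
  rw [Finset.mul_sum]
  refine (Finset.abs_sum_le_sum_abs _ _).trans (Finset.sum_le_sum fun k _ => ?_)
  calc |(x ⬝ᵥ φ k) * φ k l| ≤ Fintype.card ι * ‖x‖ * ‖φ k‖ * ‖φ k‖ := by
        rw [abs_mul]
        exact mul_le_mul (abs_dotProduct_le_card_mul_norm_mul_norm _ _) (norm_le_pi_norm (φ k) l)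
          (abs_nonneg _) (by positivity)
    _ = Fintype.card ι * ‖x‖ * ‖φ k‖ ^ 2 := by ring
    _ ≤ Fintype.card ι * ‖x‖ * (φ k ⬝ᵥ φ k) := by
        gcongr
        exact norm_sq_le_dotProduct_self (φ k)

theorem abs_sum_residual_mul_apply_le (hz : ∀ k, 1 ≤ k → z k = θ ⬝ᵥ φ k + ν k) (β : ι → ℝ) (l : ι) :
    |∑ k ∈ Finset.Icc 1 N, (z k - β ⬝ᵥ φ k) * φ k l| ≤
      ‖noiseScore φ ν N‖ + Fintype.card ι * ‖β - θ‖ * ∑ k ∈ Finset.Icc 1 N, φ k ⬝ᵥ φ k := by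
  have hsplit : ∑ k ∈ Finset.Icc 1 N, (z k - β ⬝ᵥ φ k) * φ k l =
      noiseScore φ ν N l - ∑ k ∈ Finset.Icc 1 N, ((β - θ) ⬝ᵥ φ k) * φ k l := by
    rw [noiseScore, Finset.sum_apply, ← Finset.sum_sub_distrib]
    refine Finset.sum_congr rfl fun k hk => ?_
    rw [hz k (Finset.mem_Icc.1 hk).1, sub_dotProduct, Pi.smul_apply, smul_eq_mul]
    ring
  rw [hsplit]
  exact (abs_sub _ _).trans
    (add_le_add (norm_le_pi_norm (noiseScore φ ν N) l) (abs_sum_dotProduct_mul_apply_le _ l))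

-- Deleting the coordinate `l` cannot decrease the criterion, yet it saves the penalty `ω_l |β_l|`.
theorem apply_eq_zero_of_isMinOn_weightedLasso (hz : ∀ k, 1 ≤ k → z k = θ ⬝ᵥ φ k + ν k) {l : ι}
    (hl : θ l = 0)
    (hlarge : 2 * ‖noiseScore φ ν N‖ +
      (2 * Fintype.card ι + 1) * ‖β - θ‖ * ∑ k ∈ Finset.Icc 1 N, φ k ⬝ᵥ φ k < ω l)
    (hβ : IsMinOn (weightedLasso φ z ω N) Set.univ β) : β l = 0 := by
  classical
  by_contra hne
  have hpos : 0 < |β l| := abs_pos.2 hne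
  have hβθ : |β l| ≤ ‖β - θ‖ := by simpa [hl] using norm_le_pi_norm (β - θ) l
  have hdelete := isMinOn_univ_iff.1 hβ (Function.update β l 0)
  rw [weightedLasso_update_zero] at hdelete
  have hres : β l * ∑ k ∈ Finset.Icc 1 N, (z k - β ⬝ᵥ φ k) * φ k l ≤ |β l| *
      (‖noiseScore φ ν N‖ + Fintype.card ι * ‖β - θ‖ * ∑ k ∈ Finset.Icc 1 N, φ k ⬝ᵥ φ k) := by
    refine (le_abs_self _).trans ?_
    rw [abs_mul]
    exact mul_le_mul_of_nonneg_left (abs_sum_residual_mul_apply_le hz β l) hpos.le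
  have hsq : β l ^ 2 * ∑ k ∈ Finset.Icc 1 N, φ k l ^ 2 ≤
      |β l| * (‖β - θ‖ * ∑ k ∈ Finset.Icc 1 N, φ k ⬝ᵥ φ k) := by
    rw [← sq_abs, pow_two, mul_assoc]
    exact mul_le_mul_of_nonneg_left (mul_le_mul hβθ (sum_sq_apply_le_sum_dotProduct_self φ N l)
      (Finset.sum_nonneg fun _ _ => sq_nonneg _) (norm_nonneg _)) hpos.le
  linarith [mul_lt_mul_of_pos_left hlarge hpos]

end WeightedLasso

section SupportRecovery

open Asymptotics

theorem isBigO_natCast_rpow_of_le {α α' : ℝ} (h : α ≤ α') :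
    (fun N : ℕ => (N : ℝ) ^ α) =O[atTop] fun N : ℕ => (N : ℝ) ^ α' := by
  refine IsBigO.of_norm_eventuallyLE ?_
  filter_upwards [eventually_ge_atTop 1] with N hN
  have hN' : (1 : ℝ) ≤ N := by exact_mod_cast hN
  rw [Real.norm_of_nonneg (by positivity)]
  exact Real.rpow_le_rpow_of_exponent_le hN' h

theorem tendsto_natCast_rpow_nhds_zero {α : ℝ} (hα : α < 0) :
    Tendsto (fun N : ℕ => (N : ℝ) ^ α) atTop (nhds 0) := by
  simpa only [neg_neg, Function.comp_def] using
    (tendsto_rpow_neg_atTop (neg_pos.2 hα)).comp tendsto_natCast_atTop_atTop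

theorem natCast_rpow_mul_rpow_eventuallyEq (α α' : ℝ) :
    (fun N : ℕ => (N : ℝ) ^ α * (N : ℝ) ^ α') =ᶠ[atTop] fun N : ℕ => (N : ℝ) ^ (α + α') := by
  filter_upwards [eventually_gt_atTop 0] with N hN
  rw [Real.rpow_add (by exact_mod_cast hN)]

theorem isLittleO_natCast_rpow_of_lt {α α' : ℝ} (h : α < α') :
    (fun N : ℕ => (N : ℝ) ^ α) =o[atTop] fun N : ℕ => (N : ℝ) ^ α' := by
  refine (isLittleO_iff_tendsto' ?_).2 ?_
  · filter_upwards [eventually_gt_atTop 0] with N hN hN'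
    exact absurd hN' (by positivity)
  · refine (tendsto_natCast_rpow_nhds_zero (sub_neg.2 h)).congr' ?_
    filter_upwards [eventually_gt_atTop 0] with N hN
    rw [Real.rpow_sub (by exact_mod_cast hN)]

variable {ι : Type*} [Fintype ι]

/-- The information matrix over the times `1, …, N` grows at least linearly in `N`. -/
def PersistentlyExciting (φ : ℕ → ι → ℝ) : Prop :=
  ∃ c : ℝ, 0 < c ∧ ∀ᶠ N : ℕ in atTop, IsExciting φ N (c * N)

variable [DecidableEq ι] {φ : ℕ → ι → ℝ} {z ν lam : ℕ → ℝ} {θ : ι → ℝ} {δ : ℝ}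

theorem PersistentlyExciting.isBigO_lsEstimate_sub {α : ℝ} (hφ : PersistentlyExciting φ)
    (hz : ∀ k, 1 ≤ k → z k = θ ⬝ᵥ φ k + ν k)
    (hscore : noiseScore φ ν =O[atTop] fun N : ℕ => (N : ℝ) ^ α) :
    (fun N => lsEstimate φ z N - θ) =O[atTop] fun N : ℕ => (N : ℝ) ^ (α - 1) := by
  obtain ⟨c, hc, hφ⟩ := hφ
  have hbound : (fun N => lsEstimate φ z N - θ) =O[atTop]
      fun N : ℕ => Fintype.card ι / c * (‖noiseScore φ ν N‖ * (N : ℝ) ^ (-1 : ℝ)) := by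
    refine IsBigO.of_norm_eventuallyLE ?_
    filter_upwards [hφ, eventually_gt_atTop 0] with N hN hN0
    have : (0 : ℝ) < N := by exact_mod_cast hN0
    refine (hN.norm_lsEstimate_sub_le (by positivity) hz).trans_eq ?_
    rw [Real.rpow_neg_one]
    field_simp
  exact (hbound.trans ((hscore.norm_left.mul (isBigO_refl _ _)).const_mul_left _)).trans
    (natCast_rpow_mul_rpow_eventuallyEq α (-1)).isBigO

theorem PersistentlyExciting.tendsto_lsEstimate {α : ℝ} (hφ : PersistentlyExciting φ) (hα : α < 1)
    (hz : ∀ k, 1 ≤ k → z k = θ ⬝ᵥ φ k + ν k)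
    (hscore : noiseScore φ ν =O[atTop] fun N : ℕ => (N : ℝ) ^ α) :
    Tendsto (lsEstimate φ z) atTop (nhds θ) :=
  tendsto_sub_nhds_zero_iff.1 <| (hφ.isBigO_lsEstimate_sub hz hscore).trans_tendsto <|
    tendsto_natCast_rpow_nhds_zero (sub_neg.2 hα)

theorem eventually_half_abs_le_abs_modifiedEstimate {l : ι} (hl : θ l ≠ 0)
    (hls : Tendsto (lsEstimate φ z) atTop (nhds θ)) :
    ∀ᶠ N in atTop, |θ l| / 2 ≤ |modifiedEstimate φ z N l| := by
  filter_upwards [(tendsto_pi_nhds.1 hls l).abs.eventually_const_lt (half_lt_self (abs_pos.2 hl))]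
    with N hN
  rw [abs_modifiedEstimate]
  linarith [Real.sqrt_nonneg (Real.log (lamMax φ N) / lamMin φ N)]

section Eigenvalues

variable [Nonempty ι]

theorem PersistentlyExciting.tendsto_lamMin (hφ : PersistentlyExciting φ) :
    Tendsto (lamMin φ) atTop atTop := by
  obtain ⟨c, hc, hφ⟩ := hφ
  exact tendsto_atTop_mono' _ (hφ.mono fun N hN => hN.le_lamMin)
    (tendsto_natCast_atTop_atTop.const_mul_atTop hc)

theorem PersistentlyExciting.isBigO_inv_lamMin (hφ : PersistentlyExciting φ) :
    (fun N => (lamMin φ N)⁻¹) =O[atTop] fun N : ℕ => (N : ℝ) ^ (-1 : ℝ) := by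
  obtain ⟨c, hc, hφ⟩ := hφ
  refine IsBigO.of_bound c⁻¹ ?_
  filter_upwards [hφ, eventually_gt_atTop 0] with N hN hN0
  have hcN : 0 < c * N := mul_pos hc (by exact_mod_cast hN0)
  rw [Real.rpow_neg_one, norm_inv, norm_inv, RCLike.norm_natCast, ← mul_inv]
  exact inv_anti₀ hcN (hN.le_lamMin.trans (le_abs_self _))

theorem PersistentlyExciting.tendsto_lamMax (hφ : PersistentlyExciting φ) :
    Tendsto (lamMax φ) atTop atTop :=
  tendsto_atTop_mono (fun _ => lamMin_le_lamMax) hφ.tendsto_lamMin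

theorem PersistentlyExciting.isBigO_log_lamMax {α ε : ℝ} (hφ : PersistentlyExciting φ)
    (hα : 0 < α) (hε : 0 < ε)
    (htrace : (fun N => ∑ k ∈ Finset.Icc 1 N, φ k ⬝ᵥ φ k) =O[atTop] fun N : ℕ => (N : ℝ) ^ α) :
    (fun N => Real.log (lamMax φ N)) =O[atTop] fun N : ℕ => (N : ℝ) ^ ε := by
  have hlamMax : lamMax φ =O[atTop] fun N : ℕ => (N : ℝ) ^ α := by
    refine IsBigO.trans (IsBigO.of_norm_eventuallyLE ?_) htrace
    filter_upwards [hφ.tendsto_lamMax.eventually_ge_atTop 0] with N hN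
    rw [Real.norm_of_nonneg hN]
    exact lamMax_le_sum_dotProduct_self
  have hpow : (fun N => lamMax φ N ^ (ε / α)) =O[atTop] fun N : ℕ => (N : ℝ) ^ ε := by
    have hnonneg : ∀ᶠ N : ℕ in atTop, 0 ≤ (N : ℝ) ^ α := .of_forall fun N => by positivity
    refine (hlamMax.rpow (r := ε / α) (by positivity) hnonneg).congr_right fun N => ?_
    rw [← Real.rpow_mul (by positivity), mul_div_cancel₀ _ hα.ne']
  exact ((isLittleO_log_rpow_atTop (div_pos hε hα)).comp_tendsto
    hφ.tendsto_lamMax).isBigO.trans hpow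

theorem PersistentlyExciting.isBigO_sqrt_log_lamMax_div_lamMin {α ε : ℝ}
    (hφ : PersistentlyExciting φ) (hα : 0 < α) (hε : 0 < ε)
    (htrace : (fun N => ∑ k ∈ Finset.Icc 1 N, φ k ⬝ᵥ φ k) =O[atTop] fun N : ℕ => (N : ℝ) ^ α) :
    (fun N => √(Real.log (lamMax φ N) / lamMin φ N)) =O[atTop]
      fun N : ℕ => (N : ℝ) ^ (ε - 1 / 2) := by
  have hquot : (fun N => Real.log (lamMax φ N) / lamMin φ N) =O[atTop]
      fun N : ℕ => (N : ℝ) ^ (2 * ε - 1) := by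
    simp only [div_eq_mul_inv]
    exact ((hφ.isBigO_log_lamMax hα (mul_pos two_pos hε) htrace).mul hφ.isBigO_inv_lamMin).trans
      (natCast_rpow_mul_rpow_eventuallyEq _ _).isBigO
  simp only [Real.sqrt_eq_rpow]
  refine (hquot.rpow (by norm_num) (.of_forall fun N => by positivity)).congr_right fun N => ?_
  rw [← Real.rpow_mul (by positivity)]
  congr 1
  ring

theorem PersistentlyExciting.eventually_sqrt_log_lamMax_div_lamMin_pos
    (hφ : PersistentlyExciting φ) :
    ∀ᶠ N in atTop, 0 < √(Real.log (lamMax φ N) / lamMin φ N) := by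
  filter_upwards [hφ.tendsto_lamMax.eventually_gt_atTop 1, hφ.tendsto_lamMin.eventually_gt_atTop 0]
    with N hmax hmin
  exact Real.sqrt_pos.2 (div_pos (Real.log_pos hmax) hmin)

end Eigenvalues

theorem PersistentlyExciting.eventually_modifiedEstimate_ne_zero (hφ : PersistentlyExciting φ)
    (z : ℕ → ℝ) (l : ι) : ∀ᶠ N in atTop, modifiedEstimate φ z N l ≠ 0 := by
  have : Nonempty ι := ⟨l⟩
  filter_upwards [hφ.eventually_sqrt_log_lamMax_div_lamMin_pos] with N hN
  rw [← abs_pos, abs_modifiedEstimate]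
  positivity

theorem PersistentlyExciting.isBigO_modifiedEstimate {α ε : ℝ} (hφ : PersistentlyExciting φ)
    (hα : 0 < α) (hε : 0 < ε) (hz : ∀ k, 1 ≤ k → z k = θ ⬝ᵥ φ k + ν k)
    (hscore : noiseScore φ ν =O[atTop] fun N : ℕ => (N : ℝ) ^ (ε + 1 / 2))
    (htrace : (fun N => ∑ k ∈ Finset.Icc 1 N, φ k ⬝ᵥ φ k) =O[atTop] fun N : ℕ => (N : ℝ) ^ α)
    {l : ι} (hl : θ l = 0) :
    (fun N => modifiedEstimate φ z N l) =O[atTop] fun N : ℕ => (N : ℝ) ^ (ε - 1 / 2) := by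
  have : Nonempty ι := ⟨l⟩
  have hls := isBigO_pi.1 (hφ.isBigO_lsEstimate_sub hz hscore) l
  simp only [Pi.sub_apply, hl, sub_zero, show ε + 1 / 2 - 1 = ε - 1 / 2 by ring] at hls
  refine IsBigO.of_abs_left ?_
  simp only [abs_modifiedEstimate]
  exact hls.abs_left.add (hφ.isBigO_sqrt_log_lamMax_div_lamMin hα hε htrace)

theorem PersistentlyExciting.exists_norm_sub_le_of_isSparseEstimate (hφ : PersistentlyExciting φ)
    (hz : ∀ k, 1 ≤ k → z k = θ ⬝ᵥ φ k + ν k) (hlam : ∀ᶠ N in atTop, 0 < lam N)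
    (hls : Tendsto (lsEstimate φ z) atTop (nhds θ)) :
    ∃ C : ℝ, 0 ≤ C ∧ ∀ᶠ N : ℕ in atTop, ∀ β, IsSparseEstimate φ z lam N β →
      ‖β - θ‖ ≤ C * ((‖noiseScore φ ν N‖ + lam N) / N) := by
  obtain ⟨c, hc, hφ⟩ := hφ
  have hW : 0 ≤ ∑ l, 2 / |θ l| := Finset.sum_nonneg fun l _ => by positivity
  have hweights : ∀ l, ∀ᶠ N in atTop, θ l ≠ 0 →
      lam N / |modifiedEstimate φ z N l| ≤ lam N * ∑ l, 2 / |θ l| := fun l => by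
    refine eventually_imp_distrib_left.2 fun hl => ?_
    filter_upwards [eventually_half_abs_le_abs_modifiedEstimate hl hls, hlam] with N hN hlamN
    calc lam N / |modifiedEstimate φ z N l| ≤ lam N / (|θ l| / 2) := by
          have := abs_pos.2 hl
          gcongr
      _ = lam N * (2 / |θ l|) := by rw [div_eq_mul_inv, inv_div]
      _ ≤ lam N * ∑ l, 2 / |θ l| := by
          refine mul_le_mul_of_nonneg_left ?_ hlamN.le
          exact Finset.single_le_sum (f := fun l => 2 / |θ l|) (fun l _ => by positivity)
            (Finset.mem_univ l)
  refine ⟨Fintype.card ι * (2 + ∑ l, 2 / |θ l|) / c, by positivity, ?_⟩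
  filter_upwards [hφ, hlam, eventually_all.2 hweights, eventually_gt_atTop 0]
    with N hN hlamN hωN hN0 β hβ
  have : (0 : ℝ) < N := by exact_mod_cast hN0
  refine (hN.norm_sub_le_of_isMinOn_weightedLasso (by positivity) hz (mul_nonneg hlamN.le hW)
    (fun l => by positivity) hωN (isSparseEstimate_iff_isMinOn_weightedLasso.1 hβ)).trans ?_
  rw [div_mul_div_comm, mul_assoc]
  gcongr
  nlinarith [norm_nonneg (noiseScore φ ν N)]

theorem isLittleO_mul_of_rpow {δ : ℝ} {score trace modified lam : ℕ → ℝ} (hδ : δ < 1 / 6)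
    (hδ0 : 0 ≤ δ)
    (hscore : score =O[atTop] fun N : ℕ => (N : ℝ) ^ (δ + 1 / 2))
    (htrace : trace =O[atTop] fun N : ℕ => (N : ℝ) ^ (1 + 2 * δ))
    (hmodified : modified =O[atTop] fun N : ℕ => (N : ℝ) ^ (δ - 1 / 2))
    (hlam : (fun N : ℕ => (N : ℝ) ^ (4 * δ)) =o[atTop] lam) (C C' : ℝ) :
    (fun N : ℕ => (C * score N + C' * ((score N + lam N) / N) * trace N) * modified N)
      =o[atTop] lam := by
  have hsmall : ∀ {α}, α ≤ 4 * δ → (fun N : ℕ => (N : ℝ) ^ α) =o[atTop] lam := fun hα =>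
    (isBigO_natCast_rpow_of_le hα).trans_isLittleO hlam
  have hscore_modified : (fun N => score N * modified N) =o[atTop] lam :=
    ((hscore.mul hmodified).trans (natCast_rpow_mul_rpow_eventuallyEq _ _).isBigO).trans_isLittleO
      (hsmall (by linarith))
  have htrace_modified : (fun N : ℕ => (N : ℝ) ^ (-1 : ℝ) * (trace N * modified N)) =O[atTop]
      fun N : ℕ => (N : ℝ) ^ (3 * δ - 1 / 2) := by
    refine ((isBigO_refl _ _).mul ((htrace.mul hmodified).trans
      (natCast_rpow_mul_rpow_eventuallyEq _ _).isBigO)).trans ?_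
    refine (natCast_rpow_mul_rpow_eventuallyEq _ _).isBigO.trans (isBigO_natCast_rpow_of_le ?_)
    linarith
  have hscore_trace : (fun N : ℕ => score N * ((N : ℝ) ^ (-1 : ℝ) * (trace N * modified N)))
      =o[atTop] lam :=
    ((hscore.mul htrace_modified).trans
      (natCast_rpow_mul_rpow_eventuallyEq _ _).isBigO).trans_isLittleO (hsmall (by linarith))
  have hlam_trace : (fun N : ℕ => lam N * ((N : ℝ) ^ (-1 : ℝ) * (trace N * modified N)))
      =o[atTop] lam := by
    simpa only [mul_one] using (isBigO_refl lam atTop).mul_isLittleO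
      ((isLittleO_one_iff ℝ).2 (htrace_modified.trans_tendsto
        (tendsto_natCast_rpow_nhds_zero (by linarith))))
  refine ((hscore_modified.const_mul_left C).add
    ((hscore_trace.add hlam_trace).const_mul_left C')).congr_left fun N => ?_
  rw [Real.rpow_neg_one]
  ring

theorem PersistentlyExciting.eventually_sparseAlgorithmWellDefined (hφ : PersistentlyExciting φ)
    (z : ℕ → ℝ) (hlam : ∀ᶠ N in atTop, 0 < lam N) :
    ∀ᶠ N in atTop, SparseAlgorithmWellDefined φ z lam N := by
  have hmodified := eventually_all.2 (hφ.eventually_modifiedEstimate_ne_zero z)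
  obtain ⟨c, hc, hφ⟩ := hφ
  filter_upwards [hφ, hlam, hmodified, eventually_gt_atTop 0] with N hN hlamN hmodifiedN hN0
  have hcN : 0 < c * N := mul_pos hc (by exact_mod_cast hN0)
  refine ⟨(hN.posDef_gramMatrix hcN).det_pos.ne'.isUnit, hmodifiedN, ?_⟩
  simp only [isSparseEstimate_iff_isMinOn_weightedLasso]
  exact hN.existsUnique_isMinOn_weightedLasso hcN fun l => by positivity

theorem PersistentlyExciting.eventually_isSparseEstimate_apply_eq_zero
    (hφ : PersistentlyExciting φ) (hδ : δ ∈ Set.Ioo (0 : ℝ) (1 / 6))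
    (hz : ∀ k, 1 ≤ k → z k = θ ⬝ᵥ φ k + ν k)
    (hscore : noiseScore φ ν =O[atTop] fun N : ℕ => (N : ℝ) ^ (δ + 1 / 2))
    (htrace : (fun N => ∑ k ∈ Finset.Icc 1 N, φ k ⬝ᵥ φ k)
      =O[atTop] fun N : ℕ => (N : ℝ) ^ (1 + 2 * δ))
    (hlam_pos : ∀ᶠ N in atTop, 0 < lam N)
    (hlam : (fun N : ℕ => (N : ℝ) ^ (4 * δ)) =o[atTop] lam) {l : ι} (hl : θ l = 0) :
    ∀ᶠ N in atTop, ∀ β, IsSparseEstimate φ z lam N β → β l = 0 := by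
  obtain ⟨hδ0, hδ6⟩ := hδ
  obtain ⟨C, _, hbound⟩ := hφ.exists_norm_sub_le_of_isSparseEstimate hz hlam_pos
    (hφ.tendsto_lsEstimate (by linarith) hz hscore)
  have hlarge := isLittleO_mul_of_rpow hδ6 hδ0.le hscore.norm_left htrace
    (hφ.isBigO_modifiedEstimate (by linarith) hδ0 hz hscore htrace hl).abs_left hlam 2
    ((2 * Fintype.card ι + 1) * C)
  filter_upwards [hbound, hlarge.def (half_pos one_pos), hlam_pos,
    hφ.eventually_modifiedEstimate_ne_zero z l] with N hboundN hlargeN hlamN hmodifiedN β hβ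
  have hmodified := abs_pos.2 hmodifiedN
  refine apply_eq_zero_of_isMinOn_weightedLasso hz hl ?_
    (isSparseEstimate_iff_isMinOn_weightedLasso.1 hβ)
  rw [lt_div_iff₀ hmodified]
  have htrace0 : 0 ≤ ∑ k ∈ Finset.Icc 1 N, φ k ⬝ᵥ φ k :=
    Finset.sum_nonneg fun k _ => (sq_nonneg _).trans (norm_sq_le_dotProduct_self (φ k))
  calc _ ≤ (2 * ‖noiseScore φ ν N‖ + (2 * Fintype.card ι + 1) * C *
          ((‖noiseScore φ ν N‖ + lam N) / N) * ∑ k ∈ Finset.Icc 1 N, φ k ⬝ᵥ φ k) *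
        |modifiedEstimate φ z N l| := by
        rw [mul_assoc _ C]
        gcongr
        exact hboundN β hβ
    _ ≤ 1 / 2 * ‖lam N‖ := (le_abs_self _).trans hlargeN
    _ < lam N := by rw [Real.norm_of_nonneg hlamN.le]; linarith

theorem PersistentlyExciting.eventually_isSparseEstimate_apply_ne_zero {α : ℝ}
    (hφ : PersistentlyExciting φ) (hα : α < 1) (hz : ∀ k, 1 ≤ k → z k = θ ⬝ᵥ φ k + ν k)
    (hscore : noiseScore φ ν =O[atTop] fun N : ℕ => (N : ℝ) ^ α)
    (hlam_pos : ∀ᶠ N in atTop, 0 < lam N) (hlam : lam =o[atTop] fun N : ℕ => (N : ℝ)) {l : ι}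
    (hl : θ l ≠ 0) : ∀ᶠ N in atTop, ∀ β, IsSparseEstimate φ z lam N β → β l ≠ 0 := by
  obtain ⟨C, -, hbound⟩ := hφ.exists_norm_sub_le_of_isSparseEstimate hz hlam_pos
    (hφ.tendsto_lsEstimate hα hz hscore)
  have hscore' : (fun N => ‖noiseScore φ ν N‖) =o[atTop] fun N : ℕ => (N : ℝ) := by
    simpa only [Real.rpow_one] using
      hscore.norm_left.trans_isLittleO (isLittleO_natCast_rpow_of_lt hα)
  have hzero := ((hscore'.add hlam).tendsto_div_nhds_zero.const_mul C)
  rw [mul_zero] at hzero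
  filter_upwards [hbound, hzero.eventually_lt_const (abs_pos.2 hl)] with N hN hN' β hβ hβl
  have hθl : |θ l| ≤ ‖β - θ‖ := by simpa [hβl] using norm_le_pi_norm (β - θ) l
  exact absurd (hθl.trans (hN β hβ)) (not_le.2 hN')

theorem PersistentlyExciting.eventually_wellDefined_and_support_eq (hφ : PersistentlyExciting φ)
    (hδ : δ ∈ Set.Ioo (0 : ℝ) (1 / 6)) (hz : ∀ k, 1 ≤ k → z k = θ ⬝ᵥ φ k + ν k)
    (hscore : noiseScore φ ν =O[atTop] fun N : ℕ => (N : ℝ) ^ (δ + 1 / 2))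
    (htrace : (fun N => ∑ k ∈ Finset.Icc 1 N, φ k ⬝ᵥ φ k)
      =O[atTop] fun N : ℕ => (N : ℝ) ^ (1 + 2 * δ))
    (hlam_pos : ∀ᶠ N in atTop, 0 < lam N)
    (hlam : (fun N : ℕ => (N : ℝ) ^ (4 * δ)) =o[atTop] lam)
    (hlam' : lam =o[atTop] fun N : ℕ => (N : ℝ)) :
    ∀ᶠ N in atTop, SparseAlgorithmWellDefined φ z lam N ∧
      ∀ β, IsSparseEstimate φ z lam N β → ∀ l, β l = 0 ↔ θ l = 0 := by
  have hsupport : ∀ l, ∀ᶠ N in atTop, ∀ β, IsSparseEstimate φ z lam N β →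
      (β l = 0 ↔ θ l = 0) := fun l => by
    by_cases hl : θ l = 0
    · simp only [hl, iff_true]
      exact hφ.eventually_isSparseEstimate_apply_eq_zero hδ hz hscore htrace hlam_pos hlam hl
    · simp only [hl, iff_false]
      exact hφ.eventually_isSparseEstimate_apply_ne_zero (by linarith [hδ.2]) hz hscore hlam_pos
        hlam' hl
  filter_upwards [hφ.eventually_sparseAlgorithmWellDefined z hlam_pos, eventually_all.2 hsupport]
    with N hN hN'
  exact ⟨hN, fun β hβ l => hN' l β hβ⟩

end SupportRecovery

section WeightedSums

open Asymptotics

variable {α : ℝ} {v v' : ℕ → ℝ}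

/-- Square summability with the weights `(n + 1) ^ (-α)`. For `α > 1` it holds for bounded
sequences, and it forces the partial sums of squares to be `O(N ^ α)`. -/
def WeightedSqSummable (α : ℝ) (v : ℕ → ℝ) : Prop :=
  Summable fun n : ℕ => v n ^ 2 / ((n : ℝ) + 1) ^ α

theorem isBigO_natCast_add_one_rpow (hα : 0 ≤ α) :
    (fun N : ℕ => ((N : ℝ) + 1) ^ α) =O[atTop] fun N : ℕ => (N : ℝ) ^ α := by
  refine IsBigO.rpow hα (Eventually.of_forall fun N => N.cast_nonneg) ?_
  refine IsBigO.of_bound 2 ?_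
  filter_upwards [eventually_ge_atTop 1] with N hN
  have hN' : (1 : ℝ) ≤ N := by exact_mod_cast hN
  rw [Real.norm_of_nonneg (by positivity), Real.norm_of_nonneg (by positivity)]
  linarith

theorem summable_one_div_natCast_add_one_rpow (hα : 1 < α) :
    Summable fun n : ℕ => 1 / ((n : ℝ) + 1) ^ α := by
  simpa using (summable_nat_add_iff 1).2 (Real.summable_one_div_nat_rpow.2 hα)

theorem weightedSqSummable_const (hα : 1 < α) (c : ℝ) : WeightedSqSummable α fun _ => c :=
  ((summable_one_div_natCast_add_one_rpow hα).mul_left (c ^ 2)).congr fun n => by ring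

theorem WeightedSqSummable.add (h : WeightedSqSummable α v) (h' : WeightedSqSummable α v') :
    WeightedSqSummable α fun n => v n + v' n := by
  refine Summable.of_nonneg_of_le (fun n => by positivity) (fun n => ?_)
    ((h.mul_left 2).add (h'.mul_left 2))
  rw [← mul_add, ← add_div, ← mul_div_assoc]
  gcongr
  exact add_sq_le

theorem WeightedSqSummable.const_mul (h : WeightedSqSummable α v) (c : ℝ) :
    WeightedSqSummable α fun n => c * v n :=
  (h.mul_left (c ^ 2)).congr fun n => by ring

theorem WeightedSqSummable.sum {ι : Type*} (s : Finset ι) {v : ι → ℕ → ℝ}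
    (h : ∀ i ∈ s, WeightedSqSummable α (v i)) : WeightedSqSummable α fun n => ∑ i ∈ s, v i n := by
  induction s using Finset.cons_induction_on with
  | empty => simp [WeightedSqSummable, summable_zero]
  | cons i s hi ih =>
    simp only [Finset.sum_cons]
    exact (h i (Finset.mem_cons_self _ _)).add
      (ih fun j hj => h j (Finset.mem_cons_of_mem hj))

theorem weightedSqSummable_congr (h : v =ᶠ[atTop] v') :
    WeightedSqSummable α v ↔ WeightedSqSummable α v' := by
  have h' : (fun n : ℕ => v n ^ 2 / ((n : ℝ) + 1) ^ α) =ᶠ[cofinite]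
      fun n => v' n ^ 2 / ((n : ℝ) + 1) ^ α := by
    rw [Nat.cofinite_eq_atTop]
    filter_upwards [h] with n hn
    rw [hn]
  exact summable_congr_cofinite h'

theorem weightedSqSummable_nat_add_iff (hα : 0 ≤ α) (m : ℕ) :
    WeightedSqSummable α (fun n => v (n + m)) ↔ WeightedSqSummable α v := by
  refine Iff.trans ?_ (summable_nat_add_iff m)
  constructor <;> intro h
  · refine Summable.of_nonneg_of_le (fun n => by positivity) (fun n => ?_) h
    gcongr
    linarith
  · refine Summable.of_nonneg_of_le (fun n => by positivity) (fun n => ?_)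
      (h.mul_left (((m : ℝ) + 1) ^ α))
    have hnm : ((n + m : ℕ) : ℝ) + 1 ≤ ((m : ℝ) + 1) * ((n : ℝ) + 1) := by
      push_cast
      nlinarith [mul_nonneg (Nat.cast_nonneg (α := ℝ) m) (Nat.cast_nonneg (α := ℝ) n)]
    rw [mul_div_assoc', div_le_div_iff₀ (by positivity) (by positivity), mul_assoc, mul_left_comm,
      ← Real.mul_rpow (by positivity) (by positivity)]
    gcongr

theorem WeightedSqSummable.isBigO_sum_sq (hα : 0 ≤ α) (hv : WeightedSqSummable α v) :
    (fun N => ∑ n ∈ Finset.range N, v n ^ 2) =O[atTop] fun N : ℕ => (N : ℝ) ^ α := by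
  refine IsBigO.of_bound (∑' n : ℕ, v n ^ 2 / ((n : ℝ) + 1) ^ α) (Eventually.of_forall fun N => ?_)
  rw [Real.norm_of_nonneg (by positivity), Real.norm_of_nonneg (by positivity)]
  refine le_trans ?_ (mul_le_mul_of_nonneg_right
    (hv.sum_le_tsum (Finset.range N) fun n _ => by positivity) (by positivity))
  rw [Finset.sum_mul]
  refine Finset.sum_le_sum fun n hn => ?_
  have hn' : (n : ℝ) + 1 ≤ N := by exact_mod_cast Finset.mem_range.1 hn
  rw [div_mul_eq_mul_div, le_div_iff₀ (by positivity)]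
  gcongr

/-- Summation by parts for `t n = c n * (t n / c n)`. -/
theorem abs_sum_range_sub_mul_le {t c : ℕ → ℝ} {M : ℝ} (hc : Monotone c) (hpos : ∀ n, 0 < c n)
    (h : ∀ N, |∑ n ∈ Finset.range N, t n / c n| ≤ M) (N : ℕ) :
    |∑ n ∈ Finset.range N, t n - (∑ n ∈ Finset.range N, t n / c n) * c N| ≤ M * (c N - c 0) := by
  set S : ℕ → ℝ := fun N => ∑ n ∈ Finset.range N, t n / c n with hS
  induction N with
  | zero => simp
  | succ N ih =>
    have hstep : ∑ n ∈ Finset.range (N + 1), t n - S (N + 1) * c (N + 1) =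
        (∑ n ∈ Finset.range N, t n - S N * c N) - S (N + 1) * (c (N + 1) - c N) := by
      have hsucc : S (N + 1) * c N = S N * c N + t N := by
        simp only [hS, Finset.sum_range_succ, add_mul, div_mul_cancel₀ _ (hpos N).ne']
      rw [Finset.sum_range_succ]
      linear_combination -hsucc
    have hlast : |S (N + 1) * (c (N + 1) - c N)| ≤ M * (c (N + 1) - c N) := by
      have hmono : 0 ≤ c (N + 1) - c N := sub_nonneg.2 (hc N.le_succ)
      rw [abs_mul, abs_of_nonneg hmono]
      exact mul_le_mul_of_nonneg_right (h (N + 1)) hmono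
    rw [hstep]
    linarith [abs_sub (∑ n ∈ Finset.range N, t n - S N * c N) (S (N + 1) * (c (N + 1) - c N))]

theorem abs_sum_range_le_of_abs_sum_range_div_le {t c : ℕ → ℝ} {M : ℝ} (hc : Monotone c)
    (hpos : ∀ n, 0 < c n) (h : ∀ N, |∑ n ∈ Finset.range N, t n / c n| ≤ M) (N : ℕ) :
    |∑ n ∈ Finset.range N, t n| ≤ 2 * M * c N := by
  have hM : 0 ≤ M := (abs_nonneg _).trans (h 0)
  have hmain : |(∑ n ∈ Finset.range N, t n / c n) * c N| ≤ M * c N := by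
    rw [abs_mul, abs_of_pos (hpos N)]
    exact mul_le_mul_of_nonneg_right (h N) (hpos N).le
  have hparts := abs_sum_range_sub_mul_le hc hpos h N
  have htri := abs_sub_abs_le_abs_sub (∑ n ∈ Finset.range N, t n)
    ((∑ n ∈ Finset.range N, t n / c n) * c N)
  linarith [mul_nonneg hM (hpos 0).le, mul_sub M (c N) (c 0)]

end WeightedSums

section Martingales

open scoped ENNReal Topology

variable {Ω : Type*} {mΩ : MeasurableSpace Ω} {P : Measure Ω}

theorem lintegral_mul_condLExp {m : MeasurableSpace Ω} (hm : m ≤ mΩ) [SigmaFinite (P.trim hm)]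
    {f X : Ω → ℝ≥0∞} (hf : Measurable[m] f) (hX : Measurable[mΩ] X) :
    ∫⁻ ω, f ω * P⁻[X | m] ω ∂P = ∫⁻ ω, f ω * X ω ∂P := by
  have key : ∀ Y : Ω → ℝ≥0∞, Measurable[mΩ] Y →
      ∫⁻ ω, f ω * Y ω ∂P = ∫⁻ ω, f ω ∂((P.withDensity Y).trim hm) := fun Y hY => by
    rw [lintegral_trim hm hf, lintegral_withDensity_eq_lintegral_mul P hY (hf.mono hm le_rfl)]
    simp only [Pi.mul_apply, mul_comm]
  rw [key X hX, key _ (measurable_condLExp' m P X)]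
  congr 1
  refine Measure.ext fun s hs => ?_
  rw [trim_measurableSet_eq hm hs, trim_measurableSet_eq hm hs, withDensity_apply _ (hm s hs),
    withDensity_apply _ (hm s hs), setLIntegral_condLExp hm P X hs]

theorem condLExp_mul_of_measurable_left {m : MeasurableSpace Ω} (hm : m ≤ mΩ)
    [SigmaFinite (P.trim hm)] {f X : Ω → ℝ≥0∞} (hf : Measurable[m] f) (hX : Measurable[mΩ] X) :
    P⁻[fun ω => f ω * X ω | m] =ᵐ[P] fun ω => f ω * P⁻[X | m] ω := by
  refine (ae_eq_condLExp hm P _ (hf.mul (measurable_condLExp m P X)) fun s hs => ?_).symm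
  have h := lintegral_mul_condLExp (P := P) hm (hf.indicator hs) hX
  rw [← lintegral_indicator (hm s hs), ← lintegral_indicator (hm s hs)]
  convert h using 3 with ω ω <;> by_cases hω : ω ∈ s <;> simp [hω]

theorem condLExp_of_indep {m m' : MeasurableSpace Ω} [IsProbabilityMeasure P] (hm : m ≤ mΩ)
    (hm' : m' ≤ mΩ) (hind : Indep m m' P) {X : Ω → ℝ≥0∞} (hX : Measurable[m] X) :
    P⁻[X|m'] =ᵐ[P] fun _ => ∫⁻ ω, X ω ∂P := by
  refine (ae_eq_condLExp hm' P X measurable_const fun s hs => ?_).symm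
  have h := lintegral_mul_eq_lintegral_mul_lintegral_of_independent_measurableSpace
    (μ := P) (g := s.indicator 1) hm hm' hind hX (measurable_one.indicator hs)
  rw [setLIntegral_const, ← lintegral_indicator_one (hm' s hs), ← h,
    ← lintegral_indicator (hm' s hs)]
  refine lintegral_congr fun ω => ?_
  by_cases hω : ω ∈ s <;> simp [hω]

section Compensator

variable {ℱ : Filtration ℕ mΩ} {X : ℕ → Ω → ℝ≥0∞}

/-- The event, known at time `n`, that the compensator `∑ P⁻[X j | ℱ j]` of the partial sums of `X`
has not exceeded the level `M` by the time `X n` is added. -/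
def compensatorLE (P : Measure Ω) (ℱ : Filtration ℕ mΩ) (X : ℕ → Ω → ℝ≥0∞) (M n : ℕ) : Set Ω :=
  {ω | ∑ j ∈ Finset.range (n + 1), P⁻[X j | ℱ j] ω ≤ M}

theorem measurableSet_compensatorLE (M n : ℕ) :
    MeasurableSet[ℱ n] (compensatorLE P ℱ X M n) := by
  have h : Measurable[ℱ n] fun ω => ∑ j ∈ Finset.range (n + 1), P⁻[X j | ℱ j] ω :=
    Finset.measurable_fun_sum _ fun j hj => (measurable_condLExp (ℱ j) P (X j)).mono
      (ℱ.mono (Nat.lt_succ_iff.1 (Finset.mem_range.1 hj))) le_rfl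
  exact h measurableSet_Iic

theorem mem_compensatorLE_of_tsum_le {M : ℕ} {ω : Ω} (h : ∑' n, P⁻[X n | ℱ n] ω ≤ M) (n : ℕ) :
    ω ∈ compensatorLE P ℱ X M n :=
  (ENNReal.sum_le_tsum _).trans h

theorem sum_range_indicator_compensatorLE_le (M N : ℕ) (ω : Ω) :
    ∑ n ∈ Finset.range N, (compensatorLE P ℱ X M n).indicator P⁻[X n | ℱ n] ω ≤ M := by
  induction N with
  | zero => simp
  | succ N ih =>
    rw [Finset.sum_range_succ]
    by_cases hω : ω ∈ compensatorLE P ℱ X M N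
    · rw [Set.indicator_of_mem hω]
      refine le_trans ?_ ((Finset.sum_range_succ (fun j => P⁻[X j | ℱ j] ω) N).ge.trans hω)
      gcongr
      exact Set.indicator_le_self _ _ _
    · simpa [Set.indicator_of_notMem hω] using ih

theorem tsum_setLIntegral_compensatorLE_le [IsProbabilityMeasure P] (M : ℕ) :
    ∑' n, ∫⁻ ω in compensatorLE P ℱ X M n, X n ω ∂P ≤ M := by
  have hmeas : ∀ n, MeasurableSet (compensatorLE P ℱ X M n) := fun n =>
    ℱ.le n _ (measurableSet_compensatorLE M n)
  calc ∑' n, ∫⁻ ω in compensatorLE P ℱ X M n, X n ω ∂P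
      = ∑' n, ∫⁻ ω, (compensatorLE P ℱ X M n).indicator P⁻[X n | ℱ n] ω ∂P := by
        refine tsum_congr fun n => ?_
        rw [lintegral_indicator (hmeas n),
          setLIntegral_condLExp (ℱ.le n) P (X n) (measurableSet_compensatorLE M n)]
    _ = ∫⁻ ω, ∑' n, (compensatorLE P ℱ X M n).indicator P⁻[X n | ℱ n] ω ∂P :=
        (lintegral_tsum fun n =>
          ((measurable_condLExp' (ℱ n) P (X n)).indicator (hmeas n)).aemeasurable).symm
    _ ≤ ∫⁻ _, M ∂P := lintegral_mono fun ω =>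
        ENNReal.tsum_le_of_sum_range_le fun N => sum_range_indicator_compensatorLE_le M N ω
    _ = M := by simp

theorem ae_tsum_ne_top_of_tsum_condLExp_ne_top [IsProbabilityMeasure P]
    (hX : ∀ n, Measurable (X n)) :
    ∀ᵐ ω ∂P, ∑' n, P⁻[X n | ℱ n] ω ≠ ∞ → ∑' n, X n ω ≠ ∞ := by
  have hmeas : ∀ M n, MeasurableSet (compensatorLE P ℱ X M n) := fun M n =>
    ℱ.le n _ (measurableSet_compensatorLE M n)
  have hlevel : ∀ M : ℕ, ∀ᵐ ω ∂P,
      ∑' n, (compensatorLE P ℱ X M n).indicator (X n) ω < ∞ := fun M => by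
    refine ae_lt_top (Measurable.tsum fun n => (hX n).indicator (hmeas M n)) ?_
    rw [lintegral_tsum fun n => ((hX n).indicator (hmeas M n)).aemeasurable]
    simp only [lintegral_indicator (hmeas M _)]
    exact ne_top_of_le_ne_top (ENNReal.natCast_ne_top M) (tsum_setLIntegral_compensatorLE_le M)
  filter_upwards [ae_all_iff.2 hlevel] with ω hω hfin
  obtain ⟨M, hM⟩ := ENNReal.exists_nat_gt hfin
  simpa only [Set.indicator_of_mem (mem_compensatorLE_of_tsum_le hM.le _)] using (hω M).ne

end Compensator

section SquareIntegrable

variable {ℱ : Filtration ℕ mΩ} {D : ℕ → Ω → ℝ}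

theorem martingale_sum_of_condExp_eq_zero [IsFiniteMeasure P]
    (hmeas : ∀ n, Measurable[ℱ (n + 1)] (D n)) (hint : ∀ n, Integrable (D n) P)
    (hD : ∀ n, P[D n | ℱ n] =ᵐ[P] 0) :
    Martingale (fun n ω => ∑ k ∈ Finset.range n, D k ω) ℱ P := by
  refine martingale_of_condExp_sub_eq_zero_nat (fun n => Measurable.stronglyMeasurable ?_)
    (fun n => integrable_finsetSum _ fun k _ => hint k) fun n => ?_
  · exact Finset.measurable_fun_sum _ fun k hk =>
      (hmeas k).mono (ℱ.mono (Finset.mem_range.1 hk)) le_rfl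
  · convert hD n using 2
    ext ω
    simp [Finset.sum_range_succ]

theorem integral_mul_eq_zero_of_condExp_eq_zero {m : MeasurableSpace Ω} (hm : m ≤ mΩ)
    [SigmaFinite (P.trim hm)] {f X : Ω → ℝ} (hf : StronglyMeasurable[m] f)
    (hX : Integrable X P) (hfX : Integrable (f * X) P) (h : P[X | m] =ᵐ[P] 0) :
    ∫ ω, f ω * X ω ∂P = 0 := by
  change ∫ ω, (f * X) ω ∂P = 0
  rw [← integral_condExp hm]
  refine integral_eq_zero_of_ae ?_
  filter_upwards [condExp_mul_of_stronglyMeasurable_left hf hfX hX, h] with ω hω hω0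
  simp [hω, hω0]

theorem integral_sum_sq_of_condExp_eq_zero [IsFiniteMeasure P]
    (hmeas : ∀ n, Measurable[ℱ (n + 1)] (D n)) (hL2 : ∀ n, MemLp (D n) 2 P)
    (hD : ∀ n, P[D n | ℱ n] =ᵐ[P] 0) (n : ℕ) :
    ∫ ω, (∑ k ∈ Finset.range n, D k ω) ^ 2 ∂P = ∑ k ∈ Finset.range n, ∫ ω, D k ω ^ 2 ∂P := by
  set f : ℕ → Ω → ℝ := fun n ω => ∑ k ∈ Finset.range n, D k ω with hf
  have hmart : Martingale f ℱ P := martingale_sum_of_condExp_eq_zero hmeas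
    (fun n => (hL2 n).integrable one_le_two) hD
  have hfL2 : ∀ n, MemLp (f n) 2 P := fun n => memLp_finsetSum _ fun k _ => hL2 k
  induction n with
  | zero => simp
  | succ n ih =>
    have hcross : Integrable (f n * D n) P := (hfL2 n).integrable_mul (hL2 n)
    have horth : ∫ ω, f n ω * D n ω ∂P = 0 := integral_mul_eq_zero_of_condExp_eq_zero (ℱ.le n)
      (hmart.stronglyMeasurable n) ((hL2 n).integrable one_le_two) hcross (hD n)
    calc ∫ ω, f (n + 1) ω ^ 2 ∂P
        = ∫ ω, f n ω ^ 2 + (2 * (f n ω * D n ω) + D n ω ^ 2) ∂P := by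
          refine integral_congr_ae (ae_of_all _ fun ω => ?_)
          simp only [hf, Finset.sum_range_succ]
          ring
      _ = ∫ ω, f n ω ^ 2 ∂P + ∫ ω, D n ω ^ 2 ∂P := by
          have hcross' : Integrable (fun ω => 2 * (f n ω * D n ω)) P := hcross.const_mul 2
          have hrest : Integrable (fun ω => 2 * (f n ω * D n ω) + D n ω ^ 2) P :=
            hcross'.add (hL2 n).integrable_sq
          rw [integral_add (hfL2 n).integrable_sq hrest,
            integral_add hcross' (hL2 n).integrable_sq, integral_const_mul, horth]
          ring
      _ = _ := by rw [ih, Finset.sum_range_succ]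

theorem eLpNorm_one_le_one_add_integral_sq [IsProbabilityMeasure P] {f : Ω → ℝ}
    (hf : MemLp f 2 P) : eLpNorm f 1 P ≤ ENNReal.ofReal (1 + ∫ ω, f ω ^ 2 ∂P) := by
  have hint := hf.integrable one_le_two
  rw [eLpNorm_one_eq_lintegral_enorm, ← ofReal_integral_norm_eq_lintegral_enorm hint]
  refine ENNReal.ofReal_le_ofReal ?_
  calc ∫ ω, ‖f ω‖ ∂P ≤ ∫ ω, 1 + f ω ^ 2 ∂P := by
        refine integral_mono hint.norm ((integrable_const 1).add hf.integrable_sq) fun ω => ?_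
        simp only [Real.norm_eq_abs]
        nlinarith [sq_nonneg (|f ω| - 1), sq_abs (f ω), abs_nonneg (f ω)]
    _ = 1 + ∫ ω, f ω ^ 2 ∂P := by
        rw [integral_add (integrable_const 1) hf.integrable_sq]
        simp

theorem memLp_two_of_lintegral_ofReal_sq_ne_top {f : Ω → ℝ} (hf : AEStronglyMeasurable f P)
    (h : ∫⁻ ω, ENNReal.ofReal (f ω ^ 2) ∂P ≠ ∞) : MemLp f 2 P := by
  refine (memLp_two_iff_integrable_sq hf).2 ⟨hf.pow 2, ?_⟩
  rwa [hasFiniteIntegral_iff_ofReal (ae_of_all _ fun ω => sq_nonneg _), lt_top_iff_ne_top]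

theorem ae_tendsto_sum_of_condExp_eq_zero [IsProbabilityMeasure P]
    (hmeas : ∀ n, Measurable[ℱ (n + 1)] (D n)) (hD : ∀ n, P[D n | ℱ n] =ᵐ[P] 0)
    (hsum : ∑' n, ∫⁻ ω, ENNReal.ofReal (D n ω ^ 2) ∂P ≠ ∞) :
    ∀ᵐ ω ∂P, ∃ l, Tendsto (fun n => ∑ k ∈ Finset.range n, D k ω) atTop (𝓝 l) := by
  have hL2 : ∀ n, MemLp (D n) 2 P := fun n =>
    memLp_two_of_lintegral_ofReal_sq_ne_top ((hmeas n).mono (ℱ.le _) le_rfl).aestronglyMeasurable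
      (ENNReal.ne_top_of_tsum_ne_top hsum n)
  have hsummable : Summable fun n => ∫ ω, D n ω ^ 2 ∂P := by
    refine (ENNReal.summable_toReal hsum).congr fun n => ?_
    rw [integral_eq_lintegral_of_nonneg_ae (ae_of_all _ fun ω => sq_nonneg _)
      (hL2 n).integrable_sq.aestronglyMeasurable]
  have hbdd : ∀ n, eLpNorm (fun ω => ∑ k ∈ Finset.range n, D k ω) 1 P ≤
      (1 + ∑' k, ∫ ω, D k ω ^ 2 ∂P).toNNReal := fun n => by
    refine (eLpNorm_one_le_one_add_integral_sq (memLp_finsetSum _ fun k _ => hL2 k)).trans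
      (ENNReal.ofReal_le_ofReal ?_)
    rw [integral_sum_sq_of_condExp_eq_zero hmeas hL2 hD]
    gcongr
    exact hsummable.sum_le_tsum _ fun k _ => integral_nonneg fun ω => sq_nonneg _
  exact (martingale_sum_of_condExp_eq_zero hmeas (fun n => (hL2 n).integrable one_le_two)
    hD).submartingale.exists_ae_tendsto_of_bdd hbdd

end SquareIntegrable

section PredictableSums

variable [IsProbabilityMeasure P] {ℱ : Filtration ℕ mΩ} {D a : ℕ → Ω → ℝ}

theorem ae_tendsto_sum_indicator_compensatorLE
    (hmeas : ∀ n, Measurable[ℱ (n + 1)] (D n)) (hint : ∀ n, Integrable (D n) P)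
    (hD : ∀ n, P[D n | ℱ n] =ᵐ[P] 0) (ha : ∀ n, Measurable[ℱ n] (a n)) (M : ℕ) :
    ∀ᵐ ω ∂P, ∃ l, Tendsto (fun N => ∑ n ∈ Finset.range N,
      (compensatorLE P ℱ (fun n ω => ENNReal.ofReal ((a n ω * D n ω) ^ 2)) M n).indicator (a n) ω *
        D n ω) atTop (𝓝 l) := by
  set T : ℕ → Set Ω := compensatorLE P ℱ (fun n ω => ENNReal.ofReal ((a n ω * D n ω) ^ 2)) M
  have hT : ∀ n, MeasurableSet[ℱ n] (T n) := measurableSet_compensatorLE M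
  have hTa : ∀ n, Measurable[ℱ n] ((T n).indicator (a n)) := fun n =>
    (ha n).indicator (hT n)
  have hTaD : ∀ n, Measurable[ℱ (n + 1)] fun ω => (T n).indicator (a n) ω * D n ω := fun n =>
    ((hTa n).mono (ℱ.mono n.le_succ) le_rfl).mul (hmeas n)
  have hsq : ∀ n, ∫⁻ ω, ENNReal.ofReal (((T n).indicator (a n) ω * D n ω) ^ 2) ∂P =
      ∫⁻ ω in T n, ENNReal.ofReal ((a n ω * D n ω) ^ 2) ∂P := fun n => by
    rw [← lintegral_indicator (ℱ.le n _ (hT n))]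
    refine lintegral_congr fun ω => ?_
    by_cases hω : ω ∈ T n <;> simp [hω]
  have hsum : ∑' n, ∫⁻ ω, ENNReal.ofReal (((T n).indicator (a n) ω * D n ω) ^ 2) ∂P ≠ ∞ := by
    simp only [hsq]
    exact ne_top_of_le_ne_top (ENNReal.natCast_ne_top M) (tsum_setLIntegral_compensatorLE_le M)
  refine ae_tendsto_sum_of_condExp_eq_zero hTaD (fun n => ?_) hsum
  have hL2 := memLp_two_of_lintegral_ofReal_sq_ne_top
    ((hTaD n).mono (ℱ.le _) le_rfl).aestronglyMeasurable (ENNReal.ne_top_of_tsum_ne_top hsum n)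
  refine (condExp_mul_of_stronglyMeasurable_left (hTa n).stronglyMeasurable
    (hL2.integrable one_le_two) (hint n)).trans ?_
  filter_upwards [hD n] with ω hω
  simp [hω]

theorem ae_tendsto_sum_mul_of_tsum_condLExp_ne_top
    (hmeas : ∀ n, Measurable[ℱ (n + 1)] (D n)) (hint : ∀ n, Integrable (D n) P)
    (hD : ∀ n, P[D n | ℱ n] =ᵐ[P] 0) (ha : ∀ n, Measurable[ℱ n] (a n)) :
    ∀ᵐ ω ∂P, ∑' n, P⁻[fun ω => ENNReal.ofReal ((a n ω * D n ω) ^ 2) | ℱ n] ω ≠ ∞ →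
      ∃ l, Tendsto (fun N => ∑ n ∈ Finset.range N, a n ω * D n ω) atTop (𝓝 l) := by
  filter_upwards [ae_all_iff.2 (ae_tendsto_sum_indicator_compensatorLE hmeas hint hD ha)]
    with ω hω hfin
  obtain ⟨M, hM⟩ := ENNReal.exists_nat_gt hfin
  simpa only [Set.indicator_of_mem (mem_compensatorLE_of_tsum_le hM.le _)] using hω M

end PredictableSums

end Martingales

section BoundedVariance

open Asymptotics
open scoped ENNReal Topology

variable {Ω : Type*} {mΩ : MeasurableSpace Ω} {P : Measure Ω} {ℱ : Filtration ℕ mΩ}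
  {D a : ℕ → Ω → ℝ} {α : ℝ}

/-- A martingale difference sequence with almost surely bounded conditional variances. The index is
shifted: `D n` is known at time `n + 1` and centred given `ℱ n`. -/
structure IsBoundedVarianceMDS (P : Measure Ω) (ℱ : Filtration ℕ mΩ) (D : ℕ → Ω → ℝ) :
    Prop where
  measurable : ∀ n, Measurable[ℱ (n + 1)] (D n)
  integrable : ∀ n, Integrable (D n) P
  condExp_eq_zero : ∀ n, P[D n | ℱ n] =ᵐ[P] 0
  iSup_condLExp_lt_top :
    ∀ᵐ ω ∂P, ⨆ n, P⁻[fun ω' => ENNReal.ofReal (D n ω' ^ 2) | ℱ n] ω < ∞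

namespace IsBoundedVarianceMDS

theorem ae_tsum_mul_condLExp_ne_top (hD : IsBoundedVarianceMDS P ℱ D) :
    ∀ᵐ ω ∂P, ∀ c : ℕ → ℝ, (∀ n, 0 ≤ c n) → Summable c →
      ∑' n, ENNReal.ofReal (c n) * P⁻[fun ω' => ENNReal.ofReal (D n ω' ^ 2) | ℱ n] ω ≠ ∞ := by
  filter_upwards [hD.iSup_condLExp_lt_top] with ω hω c hc hsum
  refine ne_top_of_le_ne_top ?_ (ENNReal.tsum_le_tsum fun n =>
    mul_le_mul_right (le_iSup (fun n => P⁻[fun ω' => ENNReal.ofReal (D n ω' ^ 2) | ℱ n] ω) n) _)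
  rw [ENNReal.tsum_mul_right, ← ENNReal.ofReal_tsum_of_nonneg hc hsum]
  exact ENNReal.mul_ne_top ENNReal.ofReal_ne_top hω.ne

theorem measurable_sq (hD : IsBoundedVarianceMDS P ℱ D) (n : ℕ) :
    Measurable fun ω => ENNReal.ofReal (D n ω ^ 2) :=
  (((hD.measurable n).mono (ℱ.le _) le_rfl).pow_const 2).ennreal_ofReal

variable [IsProbabilityMeasure P]

theorem ae_tendsto_sum_mul (hD : IsBoundedVarianceMDS P ℱ D) (ha : ∀ n, Measurable[ℱ n] (a n)) :
    ∀ᵐ ω ∂P, Summable (fun n => a n ω ^ 2) →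
      ∃ l, Tendsto (fun N => ∑ n ∈ Finset.range N, a n ω * D n ω) atTop (𝓝 l) := by
  have hpull : ∀ n, P⁻[fun ω => ENNReal.ofReal ((a n ω * D n ω) ^ 2) | ℱ n] =ᵐ[P]
      fun ω => ENNReal.ofReal (a n ω ^ 2) *
        P⁻[fun ω' => ENNReal.ofReal (D n ω' ^ 2) | ℱ n] ω := fun n => by
    simpa only [mul_pow, ENNReal.ofReal_mul (sq_nonneg _)] using
      condLExp_mul_of_measurable_left (P := P) (ℱ.le n) ((ha n).pow_const 2).ennreal_ofReal
        (hD.measurable_sq n)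
  filter_upwards [ae_all_iff.2 hpull, hD.ae_tsum_mul_condLExp_ne_top,
    ae_tendsto_sum_mul_of_tsum_condLExp_ne_top hD.measurable hD.integrable hD.condExp_eq_zero ha]
    with ω hω hfin hconv hsum
  exact hconv <| by simpa only [hω] using hfin _ (fun n => sq_nonneg _) hsum

theorem ae_isBigO_sum_mul (hD : IsBoundedVarianceMDS P ℱ D) (hα : 0 ≤ α)
    (ha : ∀ n, Measurable[ℱ n] (a n)) :
    ∀ᵐ ω ∂P, WeightedSqSummable α (fun n => a n ω) →
      (fun N => ∑ n ∈ Finset.range N, a n ω * D n ω) =O[atTop]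
        fun N : ℕ => (N : ℝ) ^ (α / 2) := by
  filter_upwards [hD.ae_tendsto_sum_mul (a := fun n ω => a n ω / ((n : ℝ) + 1) ^ (α / 2))
    fun n => (ha n).div_const _] with ω hconv hsum
  have hsum' : Summable fun n : ℕ => (a n ω / ((n : ℝ) + 1) ^ (α / 2)) ^ 2 := by
    refine hsum.congr fun n => ?_
    rw [div_pow, ← Real.rpow_mul_natCast (by positivity), Nat.cast_ofNat, div_mul_cancel₀ _
      two_ne_zero]
  obtain ⟨l, hl⟩ := hconv hsum'
  obtain ⟨M, hM⟩ := (Metric.isBounded_range_of_tendsto _ hl).exists_norm_le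
  refine IsBigO.trans ?_ (isBigO_natCast_add_one_rpow (by positivity))
  refine IsBigO.of_bound (2 * M) (Eventually.of_forall fun N => ?_)
  rw [Real.norm_of_nonneg (show 0 ≤ ((N : ℝ) + 1) ^ (α / 2) by positivity)]
  refine abs_sum_range_le_of_abs_sum_range_div_le
    (c := fun n : ℕ => ((n : ℝ) + 1) ^ (α / 2)) (fun m n hmn => by dsimp only; gcongr)
    (fun n => by positivity) (fun N => ?_) N
  simpa only [div_mul_eq_mul_div, Real.norm_eq_abs] using hM _ ⟨N, rfl⟩

theorem ae_weightedSqSummable (hD : IsBoundedVarianceMDS P ℱ D) (hα : 1 < α) :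
    ∀ᵐ ω ∂P, WeightedSqSummable α fun n => D n ω := by
  have hpull : ∀ n, P⁻[fun ω => ENNReal.ofReal (1 / ((n : ℝ) + 1) ^ α) *
        ENNReal.ofReal (D n ω ^ 2) | ℱ n] =ᵐ[P]
      fun ω => ENNReal.ofReal (1 / ((n : ℝ) + 1) ^ α) *
        P⁻[fun ω' => ENNReal.ofReal (D n ω' ^ 2) | ℱ n] ω := fun n =>
    condLExp_mul_of_measurable_left (ℱ.le n) measurable_const (hD.measurable_sq n)
  filter_upwards [ae_all_iff.2 hpull, hD.ae_tsum_mul_condLExp_ne_top,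
    ae_tsum_ne_top_of_tsum_condLExp_ne_top (P := P) (ℱ := ℱ)
      (X := fun n ω => ENNReal.ofReal (1 / ((n : ℝ) + 1) ^ α) * ENNReal.ofReal (D n ω ^ 2))
      fun n => (hD.measurable_sq n).const_mul _] with ω hω hfin htsum
  have hne := htsum <| by
    simpa only [hω] using hfin _ (fun n => by positivity) (summable_one_div_natCast_add_one_rpow hα)
  refine (ENNReal.summable_toReal hne).congr fun n => ?_
  rw [← ENNReal.ofReal_mul (by positivity), ENNReal.toReal_ofReal (by positivity),
    div_mul_eq_mul_div, one_mul]

end IsBoundedVarianceMDS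

/-- The filtration `n ↦ ℱ (n + m)`. -/
def shiftFiltration (ℱ : Filtration ℕ mΩ) (m : ℕ) : Filtration ℕ mΩ where
  seq n := ℱ (n + m)
  mono' _ _ h := ℱ.mono (Nat.add_le_add_right h m)
  le' n := ℱ.le (n + m)

end BoundedVariance

section Backshift

open Polynomial

variable {R : Type*} [CommSemiring R]

variable (R) in
/-- The backward shift `(S t)_k = t_{k-1}` on two-sided sequences. -/
def backshift : Module.End R (ℤ → R) := LinearMap.funLeft R R fun k => k - 1

@[simp]
theorem backshift_apply (t : ℤ → R) (k : ℤ) : backshift R t k = t (k - 1) := rfl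

@[simp]
theorem backshift_pow_apply (m : ℕ) (t : ℤ → R) (k : ℤ) :
    (backshift R ^ m) t k = t (k - m) := by
  induction m generalizing k with
  | zero => simp
  | succ m ih =>
    rw [pow_succ', Module.End.mul_apply, backshift_apply, ih, Nat.cast_succ, sub_sub,
      add_comm (1 : ℤ)]

theorem aeval_backshift_apply {Q : R[X]} {n : ℕ} (hQ : Q.natDegree < n) (t : ℤ → R) (k : ℤ) :
    aeval (backshift R) Q t k = ∑ m ∈ Finset.range n, Q.coeff m * t (k - m) := by
  simp only [aeval_eq_sum_range' hQ, LinearMap.sum_apply, LinearMap.smul_apply, Finset.sum_apply,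
    Pi.smul_apply, smul_eq_mul, backshift_pow_apply]

theorem aeval_backshift_mul (Q Q' : R[X]) (t : ℤ → R) :
    aeval (backshift R) (Q * Q') t = aeval (backshift R) Q (aeval (backshift R) Q' t) := by
  rw [map_mul, Module.End.mul_apply]

theorem aeval_backshift_map_algebraMap {S : Type*} [CommSemiring S] [Algebra R S] (Q : R[X])
    (t : ℤ → R) (k : ℤ) :
    aeval (backshift S) (Q.map (algebraMap R S)) (fun j => algebraMap R S (t j)) k =
      algebraMap R S (aeval (backshift R) Q t k) := by
  rw [aeval_backshift_apply (Nat.lt_succ_self Q.natDegree),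
    aeval_backshift_apply (Nat.lt_succ_of_le natDegree_map_le)]
  simp

end Backshift

section StableFilter

open Polynomial

variable {𝕜 : Type*} [NormedField 𝕜] {α : ℝ}

theorem summable_of_le_mul_add {x e : ℕ → ℝ} {c : ℝ} (hc : c < 1) (hx : ∀ n, 0 ≤ x n)
    (he : ∀ n, 0 ≤ e n) (hsum : Summable e) (hstep : ∀ n, x (n + 1) ≤ c * x n + e n) :
    Summable x := by
  refine summable_of_sum_range_le (c := (x 0 + ∑' n, e n) / (1 - c)) hx fun N => ?_
  have hle : ∑ n ∈ Finset.range N, x n ≤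
      c * ∑ n ∈ Finset.range N, x n + ∑' n, e n + x 0 :=
    calc ∑ n ∈ Finset.range N, x n
        ≤ ∑ n ∈ Finset.range (N + 1), x n := by
          rw [Finset.sum_range_succ]
          exact le_add_of_nonneg_right (hx N)
      _ = ∑ n ∈ Finset.range N, x (n + 1) + x 0 := Finset.sum_range_succ' x N
      _ ≤ ∑ n ∈ Finset.range N, (c * x n + e n) + x 0 := by
          gcongr with n
          exact hstep n
      _ ≤ c * ∑ n ∈ Finset.range N, x n + ∑' n, e n + x 0 := by
          rw [Finset.sum_add_distrib, ← Finset.mul_sum]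
          gcongr
          exact hsum.sum_le_tsum _ fun n _ => he n
  rw [le_div_iff₀ (sub_pos.2 hc)]
  linarith

theorem sq_le_mul_sq_add_of_mul_le_add {ρ x y e : ℝ} (hρ : 1 < ρ) (hx : 0 ≤ x)
    (h : ρ * x ≤ y + e) : x ^ 2 ≤ 1 / ρ * y ^ 2 + 1 / (ρ * (ρ - 1)) * e ^ 2 := by
  have hρ' : 0 < ρ - 1 := sub_pos.2 hρ
  have hsq : (ρ * x) ^ 2 ≤ (y + e) ^ 2 :=
    pow_le_pow_left₀ (by positivity) h 2
  have hid : ρ ^ 2 * (1 / ρ * y ^ 2 + 1 / (ρ * (ρ - 1)) * e ^ 2) - (y + e) ^ 2 =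
      ((ρ - 1) * y - e) ^ 2 / (ρ - 1) := by
    field_simp
    ring
  have hnonneg : 0 ≤ ((ρ - 1) * y - e) ^ 2 / (ρ - 1) := by positivity
  refine le_of_mul_le_mul_left (a := ρ ^ 2) ?_ (by positivity)
  linarith [mul_pow ρ x 2]

theorem weightedSqSummable_norm_of_backshift_sub (hα : 0 ≤ α) {r : 𝕜} (hr : 1 < ‖r‖) {v : ℤ → 𝕜}
    (h : WeightedSqSummable α fun n : ℕ => ‖v (n - 1) - r * v n‖) :
    WeightedSqSummable α fun n : ℕ => ‖v n‖ := by
  have : 0 < ‖r‖ - 1 := sub_pos.2 hr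
  refine summable_of_le_mul_add (c := 1 / ‖r‖) ((div_lt_one (by linarith)).2 hr)
    (fun n => by positivity)
    (e := fun n => 1 / (‖r‖ * (‖r‖ - 1)) *
      (‖v ((n + 1 : ℕ) - 1) - r * v (n + 1 : ℕ)‖ ^ 2 / (((n + 1 : ℕ) : ℝ) + 1) ^ α))
    (fun n => by positivity) (((summable_nat_add_iff 1).2 h).mul_left _) fun n => ?_
  have hnorm : ‖r‖ * ‖v (n + 1 : ℕ)‖ ≤
      ‖v n‖ + ‖v ((n + 1 : ℕ) - 1) - r * v (n + 1 : ℕ)‖ := by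
    rw [← norm_mul]
    simpa using norm_sub_le (v n) (v n - r * v (n + 1 : ℕ))
  calc ‖v (n + 1 : ℕ)‖ ^ 2 / (((n + 1 : ℕ) : ℝ) + 1) ^ α
      ≤ (1 / ‖r‖ * ‖v n‖ ^ 2 + 1 / (‖r‖ * (‖r‖ - 1)) *
          ‖v ((n + 1 : ℕ) - 1) - r * v (n + 1 : ℕ)‖ ^ 2) / (((n + 1 : ℕ) : ℝ) + 1) ^ α := by
        gcongr
        exact sq_le_mul_sq_add_of_mul_le_add hr (norm_nonneg _) hnorm
    _ ≤ _ := by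
        rw [add_div, mul_div_assoc, mul_div_assoc]
        gcongr
        exact n.le_succ

theorem weightedSqSummable_norm_of_aeval_backshift [IsAlgClosed 𝕜] (hα : 0 ≤ α) {Q : 𝕜[X]}
    (hQ : ∀ z : 𝕜, ‖z‖ ≤ 1 → Q.eval z ≠ 0) {v : ℤ → 𝕜}
    (h : WeightedSqSummable α fun n : ℕ => ‖aeval (backshift 𝕜) Q v n‖) :
    WeightedSqSummable α fun n : ℕ => ‖v n‖ := by
  induction hd : Q.natDegree generalizing Q with
  | zero =>
    obtain ⟨c, rfl⟩ := natDegree_eq_zero.1 hd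
    have hc : c ≠ 0 := by simpa using hQ 0 (by simp)
    have hscaled := h.const_mul ‖c‖⁻¹
    simpa [hc] using hscaled
  | succ d ih =>
    obtain ⟨r, hr⟩ := IsAlgClosed.exists_root Q fun h0 =>
      absurd (hd.symm.trans (natDegree_eq_of_degree_eq_some h0)) d.succ_ne_zero
    have hr1 : 1 < ‖r‖ := not_le.1 fun hle => hQ r hle hr
    obtain ⟨Q', rfl⟩ := dvd_iff_isRoot.2 hr
    have hQ' : Q' ≠ 0 := by
      rintro rfl
      simp at hd
    rw [natDegree_mul (X_sub_C_ne_zero r) hQ', natDegree_X_sub_C] at hd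
    refine ih (Q := Q') (fun z hz h0 => hQ z hz (by simp [h0])) ?_ (by lia)
    refine weightedSqSummable_norm_of_backshift_sub hα hr1 ?_
    simpa [aeval_backshift_mul] using h

theorem weightedSqSummable_of_aeval_backshift (hα : 0 ≤ α) {Q : ℝ[X]}
    (hQ : ∀ z : ℂ, ‖z‖ ≤ 1 → aeval z Q ≠ 0) {v : ℤ → ℝ}
    (h : WeightedSqSummable α fun n : ℕ => aeval (backshift ℝ) Q v n) :
    WeightedSqSummable α fun n : ℕ => v n := by
  have hQ' : ∀ z : ℂ, ‖z‖ ≤ 1 → (Q.map (algebraMap ℝ ℂ)).eval z ≠ 0 := fun z hz => by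
    rw [eval_map_algebraMap]
    exact hQ z hz
  have hnorm := weightedSqSummable_norm_of_aeval_backshift hα hQ'
    (v := fun j => algebraMap ℝ ℂ (v j))
  simp only [aeval_backshift_map_algebraMap, norm_algebraMap', WeightedSqSummable,
    Real.norm_eq_abs, sq_abs] at hnorm
  exact hnorm h

end StableFilter

section HammersteinAlgebra

open Polynomial

variable {p q s : ℕ} {a : Fin p → ℝ} {b : Fin q → ℝ} {d : Fin s → ℝ} {g : Fin s → ℝ → ℝ}
  {y u : ℤ → ℝ} {w : ℕ → ℝ}

/-- `inputPoly` as a linear map. -/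
noncomputable def inputPolyHom (q : ℕ) : (Fin q → ℝ) →ₗ[ℝ] ℝ[X] where
  toFun := inputPoly
  map_add' b b' := by simp [inputPoly, add_mul, Finset.sum_add_distrib]
  map_smul' t b := by simp [inputPoly, Finset.smul_sum, smul_eq_C_mul, mul_assoc]

theorem natDegree_inputPoly_le (b : Fin q → ℝ) : (inputPoly b).natDegree ≤ q :=
  natDegree_sum_le_of_forall_le _ _ fun i _ => (natDegree_C_mul_X_pow_le _ _).trans i.2.le

theorem natDegree_arPoly_le (a : Fin p → ℝ) : (arPoly a).natDegree ≤ p :=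
  (natDegree_sub_le _ _).trans <| max_le (by simp) <|
    natDegree_sum_le_of_forall_le _ _ fun i _ => (natDegree_C_mul_X_pow_le _ _).trans i.2

theorem aeval_inputPoly_apply (b : Fin q → ℝ) (t : ℤ → ℝ) (k : ℤ) :
    aeval (backshift ℝ) (inputPoly b) t k = ∑ i : Fin q, b i * t (k - (i : ℕ)) := by
  simp [inputPoly, map_sum, Finset.sum_apply]

theorem aeval_arPoly_apply (a : Fin p → ℝ) (t : ℤ → ℝ) (k : ℤ) :
    aeval (backshift ℝ) (arPoly a) t k = t k - ∑ i : Fin p, a i * t (k - ((i : ℕ) + 1)) := by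
  simp [arPoly, map_sum, Finset.sum_apply]

/-- The signals that drive the system at time `k`: the noise `w_{k+1}` and the transformed inputs
`g_j(u_k)`. -/
def drivingSignal (g : Fin s → ℝ → ℝ) (u : ℤ → ℝ) (w : ℕ → ℝ) : Unit ⊕ Fin s → ℤ → ℝ :=
  Sum.elim (fun _ k => w (k + 1).toNat) fun j k => g j (u k)

/-- The polynomials in the backward shift through which the driving signals enter `A(S) (xᵀφ)`, for
a fixed direction `x` in the space of regressors. -/
noncomputable def channelPoly (a : Fin p → ℝ) (b : Fin q → ℝ) (d : Fin s → ℝ) :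
    (Fin p ⊕ (Fin q × Fin s) → ℝ) →ₗ[ℝ] (Unit ⊕ Fin s → ℝ[X]) :=
  let noisePoly := .mulLeft ℝ X ∘ₗ inputPolyHom p ∘ₗ .funLeft ℝ ℝ Sum.inl
  .pi <| Sum.elim (fun _ => noisePoly) fun j =>
    d j • (.mulRight ℝ (inputPoly b) ∘ₗ noisePoly) +
      .mulLeft ℝ (arPoly a) ∘ₗ inputPolyHom q ∘ₗ .funLeft ℝ ℝ fun i => Sum.inr (i, j)

theorem channelPoly_inl (x : Fin p ⊕ (Fin q × Fin s) → ℝ) (i : Unit) :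
    channelPoly a b d x (Sum.inl i) = X * inputPoly (x ∘ Sum.inl) := rfl

theorem channelPoly_inr (x : Fin p ⊕ (Fin q × Fin s) → ℝ) (j : Fin s) :
    channelPoly a b d x (Sum.inr j) = d j • (X * inputPoly (x ∘ Sum.inl) * inputPoly b) +
      arPoly a * inputPoly fun i => x (Sum.inr (i, j)) := rfl

theorem natDegree_channelPoly_le (x : Fin p ⊕ (Fin q × Fin s) → ℝ) (c : Unit ⊕ Fin s) :
    (channelPoly a b d x c).natDegree ≤ p + q + 1 := by
  have hnoise : (X * inputPoly (x ∘ Sum.inl)).natDegree ≤ 1 + p :=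
    natDegree_mul_le_of_le natDegree_X_le (natDegree_inputPoly_le _)
  rcases c with _ | j
  · exact hnoise.trans (by lia)
  · refine natDegree_add_le_of_degree_le ((natDegree_smul_le _ _).trans ?_) ?_
    · exact (natDegree_mul_le_of_le hnoise (natDegree_inputPoly_le b)).trans (by lia)
    · exact (natDegree_mul_le_of_le (natDegree_arPoly_le a) (natDegree_inputPoly_le _)).trans
        (by lia)

theorem dotProduct_hammersteinRegressor (g : Fin s → ℝ → ℝ) (y u : ℤ → ℝ) (w : ℕ → ℝ) (k : ℕ)
    (x : Fin p ⊕ (Fin q × Fin s) → ℝ) :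
    x ⬝ᵥ hammersteinRegressor p q g y u k =
      (aeval (backshift ℝ) (inputPoly (x ∘ Sum.inl)) y +
        ∑ j, aeval (backshift ℝ) (inputPoly fun i => x (Sum.inr (i, j)))
          (drivingSignal g u w (Sum.inr j))) k := by
  simp only [Pi.add_apply, Finset.sum_apply, aeval_inputPoly_apply, dotProduct,
    Fintype.sum_sum_type, hammersteinRegressor, Sum.elim_inl, Sum.elim_inr,
    Fintype.sum_prod_type_right, Function.comp_apply, drivingSignal]

theorem aeval_arPoly_add_sum (x : Fin p ⊕ (Fin q × Fin s) → ℝ) (y : ℤ → ℝ)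
    (v : Fin s → ℤ → ℝ) :
    aeval (backshift ℝ) (arPoly a) (aeval (backshift ℝ) (inputPoly (x ∘ Sum.inl)) y +
        ∑ j, aeval (backshift ℝ) (inputPoly fun i => x (Sum.inr (i, j))) (v j)) =
      aeval (backshift ℝ) (inputPoly (x ∘ Sum.inl)) (aeval (backshift ℝ) (arPoly a) y -
        ∑ j, d j • aeval (backshift ℝ) (X * inputPoly b) (v j)) +
      ∑ j, aeval (backshift ℝ) (channelPoly a b d x (Sum.inr j)) (v j) := by
  simp only [channelPoly_inr, map_add, map_sum, map_sub, map_smul, LinearMap.add_apply,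
    LinearMap.smul_apply, ← aeval_backshift_mul, Finset.sum_add_distrib]
  simp only [mul_comm, mul_assoc]
  abel

theorem IsHammersteinPath.aeval_arPoly_sub (h : IsHammersteinPath a b d g y u w) {k : ℤ}
    (hk : 2 ≤ k) :
    (aeval (backshift ℝ) (arPoly a) y - ∑ j, d j •
      aeval (backshift ℝ) (X * inputPoly b) (drivingSignal g u w (Sum.inr j))) k =
        drivingSignal g u w (Sum.inl ()) (k - 1) := by
  obtain ⟨n, rfl⟩ : ∃ n : ℕ, k = ((n + 1 : ℕ) : ℤ) + 1 := ⟨(k - 2).toNat, by lia⟩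
  have hlag : ∀ i : ℤ, (((n + 1 : ℕ) : ℤ) + 1 - (i + 1)) = ((n + 1 : ℕ) : ℤ) - i :=
    fun i => by ring
  have hnoise : (((n + 1 : ℕ) : ℤ) + 1).toNat = n + 1 + 1 := by lia
  simp only [Pi.sub_apply, Finset.sum_apply, Pi.smul_apply, smul_eq_mul, aeval_arPoly_apply,
    aeval_backshift_mul, aeval_X, backshift_apply, aeval_inputPoly_apply, drivingSignal,
    Sum.elim_inl, Sum.elim_inr, h (n + 1) (Nat.le_add_left 1 n), hlag, add_sub_cancel_right,
    hnoise, Finset.mul_sum]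
  rw [Finset.sum_comm]
  simp only [mul_left_comm (d _) (b _)]
  ring

theorem IsHammersteinPath.filtered_dotProduct (h : IsHammersteinPath a b d g y u w)
    (x : Fin p ⊕ (Fin q × Fin s) → ℝ) {k : ℕ} (hk : p + 2 ≤ k) :
    x ⬝ᵥ hammersteinRegressor p q g y u k -
        ∑ i : Fin p, a i * (x ⬝ᵥ hammersteinRegressor p q g y u (k - (i + 1))) =
      ∑ c, aeval (backshift ℝ) (channelPoly a b d x c) (drivingSignal g u w c) k := by
  have hcast : ∀ i : Fin p, ((k - (i + 1) : ℕ) : ℤ) = (k : ℤ) - ((i : ℕ) + 1) := fun i => by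
    have := i.2
    lia
  have hnoise : aeval (backshift ℝ) (inputPoly (x ∘ Sum.inl))
      (aeval (backshift ℝ) (arPoly a) y - ∑ j, d j •
        aeval (backshift ℝ) (X * inputPoly b) (drivingSignal g u w (Sum.inr j))) k =
      aeval (backshift ℝ) (channelPoly a b d x (Sum.inl ()))
        (drivingSignal g u w (Sum.inl ())) k := by
    rw [channelPoly_inl, aeval_backshift_mul, aeval_X, backshift_apply, aeval_inputPoly_apply,
      aeval_inputPoly_apply]
    refine Finset.sum_congr rfl fun i _ => ?_
    rw [h.aeval_arPoly_sub (by have := i.2; lia), sub_right_comm]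
  simp only [dotProduct_hammersteinRegressor g y u w, hcast]
  rw [← aeval_arPoly_apply, aeval_arPoly_add_sum (b := b) (d := d), Pi.add_apply, hnoise,
    Fintype.sum_sum_type, Finset.sum_apply]
  simp only [Finset.univ_unique, Finset.sum_singleton]

end HammersteinAlgebra

section Identifiability

open Polynomial

variable {p q s : ℕ} {a : Fin p → ℝ} {b : Fin q → ℝ} {d : Fin s → ℝ}

theorem coeff_inputPoly (b : Fin q → ℝ) (i : Fin q) : (inputPoly b).coeff i = b i := by
  simp [inputPoly, finsetSum_coeff, coeff_X_pow, Fin.val_inj]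

theorem inputPoly_eq_zero_iff : inputPoly b = 0 ↔ b = 0 := by
  refine ⟨fun h => funext fun i => ?_, fun h => by simp [h, inputPoly]⟩
  rw [← coeff_inputPoly b i, h, coeff_zero, Pi.zero_apply]

theorem degree_inputPoly_lt (b : Fin q → ℝ) : (inputPoly b).degree < q :=
  degree_sum_fin_lt b

theorem coeff_zero_arPoly (a : Fin p → ℝ) : (arPoly a).coeff 0 = 1 := by
  simp [arPoly]

theorem arPoly_ne_zero (a : Fin p → ℝ) : arPoly a ≠ 0 := fun h => by
  simpa [h] using coeff_zero_arPoly a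

theorem isCoprime_arPoly_X (a : Fin p → ℝ) : IsCoprime (arPoly a) X := by
  refine (irreducible_X.coprime_iff_not_dvd.2 ?_).symm
  rw [X_dvd_iff, coeff_zero_arPoly]
  exact one_ne_zero

theorem eq_zero_of_channelPoly_eq_zero {x : Fin p ⊕ (Fin q × Fin s) → ℝ}
    (h : channelPoly a b d x = 0) : x = 0 := by
  have hnoise : x ∘ Sum.inl = 0 := by
    simpa [channelPoly_inl, inputPoly_eq_zero_iff] using congrFun h (Sum.inl ())
  ext (i | ⟨i, j⟩)
  · exact congrFun hnoise i
  · have hj := congrFun h (Sum.inr j)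
    rw [channelPoly_inr, inputPoly_eq_zero_iff.2 hnoise, mul_zero, zero_mul, smul_zero, zero_add,
      Pi.zero_apply, mul_eq_zero, or_iff_right (arPoly_ne_zero a), inputPoly_eq_zero_iff] at hj
    exact congrFun hj i

theorem MinimalSystem.eq_zero_of_channelPoly_inr_eq_zero (hmin : MinimalSystem a b d)
    {x : Fin p ⊕ (Fin q × Fin s) → ℝ} (h : ∀ j, channelPoly a b d x (Sum.inr j) = 0) :
    x = 0 := by
  obtain ⟨hcop, hdeg, hd⟩ := hmin
  obtain ⟨j, hj⟩ : ∃ j, d j ≠ 0 := Function.ne_iff.1 hd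
  set F : ℝ[X] := inputPoly (x ∘ Sum.inl) with hF
  set G : ℝ[X] := inputPoly fun i => x (Sum.inr (i, j))
  have hcop' : IsCoprime (arPoly a) (X * inputPoly b) := (isCoprime_arPoly_X a).mul_right hcop
  have heq : d j • (F * (X * inputPoly b)) = -(arPoly a * G) := by
    rw [mul_left_comm, ← mul_assoc]
    exact eq_neg_of_add_eq_zero_left (h j)
  have hunit : IsUnit (C (d j)) := isUnit_C.2 hj.isUnit
  have hF0 : F = 0 := by
    rcases hdeg with hdeg | hdeg
    · have hdvd : arPoly a ∣ F * (X * inputPoly b) := by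
        rw [← hunit.dvd_mul_left, ← smul_eq_C_mul, heq, dvd_neg]
        exact dvd_mul_right _ _
      exact eq_zero_of_dvd_of_degree_lt (hcop'.dvd_of_dvd_mul_right hdvd)
        ((degree_inputPoly_lt _).trans_le (le_degree_of_ne_zero hdeg))
    · have hdvd : X * inputPoly b ∣ arPoly a * G := by
        rw [← dvd_neg, ← heq]
        exact smul_eq_C_mul (d j) ▸ (dvd_mul_left _ _).mul_left _
      have hG0 : G = 0 := eq_zero_of_dvd_of_degree_lt (hcop'.symm.dvd_of_dvd_mul_left hdvd)
        ((degree_inputPoly_lt _).trans_le (le_degree_of_ne_zero hdeg))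
      have hB : X * inputPoly b ≠ 0 := fun h0 => hdeg (by simp [h0])
      rw [hG0, mul_zero, neg_zero, smul_eq_zero, or_iff_right hj, mul_eq_zero,
        or_iff_left hB] at heq
      exact heq
  refine eq_zero_of_channelPoly_eq_zero (a := a) (b := b) (d := d) (funext ?_)
  rintro (_ | j)
  · rw [channelPoly_inl, ← hF, hF0, mul_zero, Pi.zero_apply]
  · exact h j

end Identifiability

section TimeAverages

open scoped Topology

/-- The running averages of `t` converge to `r`. -/
def HasTimeAverage (t : ℕ → ℝ) (r : ℝ) : Prop :=
  Tendsto (fun N : ℕ => (∑ n ∈ Finset.range N, t n) / N) atTop (𝓝 r)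

/-- The lower limit of the running averages of `t` is at least `r`. Stated without `liminf`, so that
unbounded averages are allowed. -/
def HasTimeAverageGE (t : ℕ → ℝ) (r : ℝ) : Prop :=
  ∀ r' < r, ∀ᶠ N : ℕ in atTop, r' * N ≤ ∑ n ∈ Finset.range N, t n

theorem sum_range_comp_add (t : ℕ → ℝ) (m N : ℕ) :
    ∑ n ∈ Finset.range N, t (n + m) =
      ∑ n ∈ Finset.range (N + m), t n - ∑ n ∈ Finset.range m, t n := by
  rw [add_comm N, Finset.sum_range_add, add_sub_cancel_left]
  simp only [add_comm]

theorem HasTimeAverage.nat_add {t : ℕ → ℝ} {r : ℝ} (h : HasTimeAverage t r) (m : ℕ) :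
    HasTimeAverage (fun n => t (n + m)) r := by
  have hm : Tendsto (fun N : ℕ => 1 + (m : ℝ) / N) atTop (𝓝 (1 + 0)) :=
    (tendsto_const_div_atTop_nhds_zero_nat _).const_add _
  have hinit := tendsto_const_div_atTop_nhds_zero_nat (∑ n ∈ Finset.range m, t n)
  have hlim := ((h.comp (tendsto_add_atTop_nat m)).mul hm).sub hinit
  rw [add_zero, mul_one, sub_zero] at hlim
  refine hlim.congr' ?_
  filter_upwards [eventually_gt_atTop 0] with N hN
  have hN' : (N : ℝ) ≠ 0 := Nat.cast_ne_zero.2 hN.ne'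
  have hNm : (N : ℝ) + m ≠ 0 := by positivity
  rw [Function.comp_apply, sum_range_comp_add, Nat.cast_add]
  field_simp

theorem HasTimeAverage.hasTimeAverageGE {t : ℕ → ℝ} {r : ℝ} (h : HasTimeAverage t r) :
    HasTimeAverageGE t r := fun r' hr' => by
  filter_upwards [h.eventually_const_lt hr', eventually_gt_atTop 0] with N hN hN0
  exact ((lt_div_iff₀ (Nat.cast_pos.2 hN0)).1 hN).le

theorem HasTimeAverageGE.nat_add {t : ℕ → ℝ} {r : ℝ} (h : HasTimeAverageGE t r) (m : ℕ) :
    HasTimeAverageGE (fun n => t (n + m)) r := by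
  intro r' hr'
  obtain ⟨r'', hr'r'', hr''⟩ := exists_between hr'
  have hlin : Tendsto (fun N : ℕ => (r'' - r') * N) atTop atTop :=
    tendsto_natCast_atTop_atTop.const_mul_atTop (sub_pos.2 hr'r'')
  filter_upwards [(tendsto_add_atTop_nat m).eventually (h r'' hr''),
    hlin.eventually_ge_atTop (∑ n ∈ Finset.range m, t n - r'' * m)] with N hN hN'
  rw [Nat.cast_add] at hN
  rw [sum_range_comp_add]
  linarith

/-- The signals `η c` have the time-averaged second moments `R`, where for the diagonal moments
only the lower bounds are required. -/
structure HasTimeMoments {I : Type*} (η : I → ℕ → ℝ) (R : Matrix I I ℝ) : Prop where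
  offDiag : ∀ c c', c ≠ c' → HasTimeAverage (fun n => η c n * η c' n) (R c c')
  diag : ∀ c, HasTimeAverageGE (fun n => η c n ^ 2) (R c c)

variable {I : Type*} {η : I → ℕ → ℝ} {R : Matrix I I ℝ}

theorem HasTimeMoments.eventually_sub_mul_le (h : HasTimeMoments η R) (c c' : I) {ε : ℝ}
    (hε : 0 < ε) : ∀ᶠ N : ℕ in atTop, ∀ x : I → ℝ,
      (x c * x c' * R c c' - ε * (|x c| * |x c'|)) * N ≤
        ∑ n ∈ Finset.range N, x c * η c n * (x c' * η c' n) := by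
  have hfactor : ∀ (x : I → ℝ) N, ∑ n ∈ Finset.range N, x c * η c n * (x c' * η c' n) =
      x c * x c' * ∑ n ∈ Finset.range N, η c n * η c' n := fun x N => by
    simp only [Finset.mul_sum, mul_mul_mul_comm]
  simp only [hfactor]
  rcases eq_or_ne c c' with rfl | hcc'
  · filter_upwards [h.diag c (R c c - ε) (sub_lt_self _ hε)] with N hN x
    calc (x c * x c * R c c - ε * (|x c| * |x c|)) * N = x c * x c * ((R c c - ε) * N) := by
          rw [abs_mul_abs_self]
          ring
      _ ≤ x c * x c * ∑ n ∈ Finset.range N, η c n * η c n := by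
          refine mul_le_mul_of_nonneg_left ?_ (mul_self_nonneg _)
          simpa only [pow_two] using hN
  · filter_upwards [Metric.tendsto_nhds.1 (h.offDiag c c' hcc') ε hε, eventually_gt_atTop 0]
      with N hN hN0 x
    set T : ℝ := ∑ n ∈ Finset.range N, η c n * η c' n
    have hdev : |x c * x c' * (T / N - R c c')| ≤ ε * (|x c| * |x c'|) := by
      rw [abs_mul, abs_mul, mul_comm ε]
      exact mul_le_mul_of_nonneg_left hN.le (by positivity)
    calc (x c * x c' * R c c' - ε * (|x c| * |x c'|)) * N ≤ x c * x c' * (T / N) * N := by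
          refine mul_le_mul_of_nonneg_right ?_ N.cast_nonneg
          linarith [neg_le_of_abs_le hdev]
      _ = x c * x c' * T := by field_simp

variable [Fintype I]

theorem HasTimeMoments.eventually_quadratic_sub_mul_le (h : HasTimeMoments η R) {ε : ℝ}
    (hε : 0 < ε) : ∀ᶠ N : ℕ in atTop, ∀ x : I → ℝ,
      (x ⬝ᵥ R *ᵥ x - ε * (∑ c, |x c|) ^ 2) * N ≤
        ∑ n ∈ Finset.range N, (x ⬝ᵥ fun c => η c n) ^ 2 := by
  filter_upwards [eventually_all.2 fun c => eventually_all.2 fun c' =>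
    h.eventually_sub_mul_le c c' hε] with N hN x
  calc (x ⬝ᵥ R *ᵥ x - ε * (∑ c, |x c|) ^ 2) * N
      = ∑ c, ∑ c', (x c * x c' * R c c' - ε * (|x c| * |x c'|)) * N := by
        rw [pow_two, Finset.sum_mul_sum]
        simp only [dotProduct, mulVec, Finset.sum_sub_distrib, ← Finset.sum_mul, Finset.mul_sum,
          mul_assoc, mul_comm (R _ _)]
    _ ≤ ∑ c, ∑ c', ∑ n ∈ Finset.range N, x c * η c n * (x c' * η c' n) :=
        Finset.sum_le_sum fun c _ => Finset.sum_le_sum fun c' _ => hN c c' x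
    _ = ∑ n ∈ Finset.range N, (x ⬝ᵥ fun c => η c n) ^ 2 := by
        simp only [dotProduct, pow_two, Finset.sum_mul_sum]
        rw [Finset.sum_comm (s := Finset.range N)]
        exact Finset.sum_congr rfl fun c _ => Finset.sum_comm

theorem exists_pos_forall_mul_le_of_homogeneous {ι : Type*} [Finite ι] {G Q : (ι → ℝ) → ℝ}
    (hG : Continuous G) (hQ : Continuous Q) (hG2 : ∀ (t : ℝ) x, G (t • x) = t ^ 2 * G x)
    (hQ2 : ∀ (t : ℝ) x, Q (t • x) = t ^ 2 * Q x) (hpos : ∀ x ≠ 0, 0 < Q x) :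
    ∃ c : ℝ, 0 < c ∧ ∀ x, c * G x ≤ Q x := by
  cases nonempty_fintype ι
  have hne : ∀ y ∈ Metric.sphere (0 : ι → ℝ) 1, 0 < Q y := fun y hy =>
    hpos y (ne_zero_of_mem_unit_sphere ⟨y, hy⟩)
  obtain ⟨C, hC⟩ := (isCompact_sphere (0 : ι → ℝ) 1).exists_bound_of_continuousOn
    (hG.continuousOn.div hQ.continuousOn fun y hy => (hne y hy).ne')
  refine ⟨(|C| + 1)⁻¹, by positivity, fun x => ?_⟩
  rw [inv_mul_le_iff₀ (by positivity)]
  rcases eq_or_ne x 0 with rfl | hx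
  · have hG0 : G 0 = 0 := by simpa using hG2 0 0
    have hQ0 : Q 0 = 0 := by simpa using hQ2 0 0
    rw [hG0, hQ0, mul_zero]
  · have hy : ‖x‖⁻¹ • x ∈ Metric.sphere (0 : ι → ℝ) 1 := by
      rw [mem_sphere_zero_iff_norm, norm_smul, norm_inv, norm_norm,
        inv_mul_cancel₀ (norm_ne_zero_iff.2 hx)]
    have hle : G (‖x‖⁻¹ • x) ≤ (|C| + 1) * Q (‖x‖⁻¹ • x) := by
      rw [← div_le_iff₀ (hne _ hy)]
      exact (le_abs_self _).trans <| (hC _ hy).trans <| (le_abs_self C).trans (by linarith)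
    rw [hG2, hQ2, mul_left_comm] at hle
    exact le_of_mul_le_mul_left hle (by positivity)

theorem HasTimeMoments.exists_forall_mul_le (h : HasTimeMoments η R) {ι : Type*} [Fintype ι]
    (L : (ι → ℝ) →ₗ[ℝ] (I → ℝ)) (hpos : ∀ x ≠ 0, 0 < L x ⬝ᵥ R *ᵥ L x) :
    ∃ κ : ℝ, 0 < κ ∧ ∀ᶠ N : ℕ in atTop, ∀ x,
      κ * N * (x ⬝ᵥ x) ≤ ∑ n ∈ Finset.range N, (L x ⬝ᵥ fun c => η c n) ^ 2 := by
  have hL : Continuous L := L.continuous_of_finiteDimensional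
  obtain ⟨κ, hκ, hle⟩ := exists_pos_forall_mul_le_of_homogeneous
    (G := fun x => x ⬝ᵥ x + (∑ c, |L x c|) ^ 2) (Q := fun x => L x ⬝ᵥ R *ᵥ L x)
    (by unfold dotProduct; fun_prop) (by unfold dotProduct mulVec dotProduct; fun_prop)
    (fun t x => by
      simp only [dotProduct_smul, smul_dotProduct, map_smul, Pi.smul_apply, smul_eq_mul, abs_mul,
        ← Finset.mul_sum, mul_pow, sq_abs]
      ring)
    (fun t x => by
      simp only [map_smul, mulVec_smul, dotProduct_smul, smul_dotProduct, smul_eq_mul]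
      ring) hpos
  refine ⟨κ, hκ, ?_⟩
  filter_upwards [h.eventually_quadratic_sub_mul_le hκ] with N hN x
  refine le_trans ?_ (hN (L x))
  rw [mul_right_comm]
  exact mul_le_mul_of_nonneg_right (by linarith [hle x]) N.cast_nonneg

end TimeAverages

section WhiteNoise

/-- The signals `ξ j` behave, along time averages, like white noise with mean zero and covariance
matrix `C`. -/
structure IsWhite {J : Type*} (ξ : J → ℕ → ℝ) (C : Matrix J J ℝ) : Prop where
  mean : ∀ j, HasTimeAverage (ξ j) 0
  lag : ∀ j j' k, HasTimeAverage (fun n => ξ j n * ξ j' (n + (k + 1))) 0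
  moments : HasTimeMoments ξ C

variable {J : Type*} {ξ : J → ℕ → ℝ} {C : Matrix J J ℝ}

theorem IsWhite.hasTimeAverage_of_ne (h : IsWhite ξ C) (j j' : J) {m m' : ℕ} (hm : m ≠ m') :
    HasTimeAverage (fun n => ξ j (n + m) * ξ j' (n + m')) 0 := by
  wlog hlt : m < m' generalizing j j' m m'
  · simpa only [mul_comm] using this j' j hm.symm (by lia)
  · obtain ⟨k, rfl⟩ := Nat.exists_eq_add_of_lt hlt
    simpa only [add_assoc] using (h.lag j j' k).nat_add m

theorem IsWhite.hasTimeMoments_lagged (h : IsWhite ξ C) (M : ℕ) :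
    HasTimeMoments
      (Sum.elim (fun jm : J × Fin M => fun n => ξ jm.1 (n + jm.2.rev)) fun _ : Unit => 1)
      (fromBlocks (blockDiagonal fun _ => C) 0 0 0) where
  offDiag := by
    rintro (⟨j, m⟩ | _) (⟨j', m'⟩ | _) hne
    · rcases eq_or_ne m m' with rfl | hm
      · have hj : j ≠ j' := fun hj => hne (by rw [hj])
        simpa using (h.moments.offDiag j j' hj).nat_add _
      · have hrev : (m.rev : ℕ) ≠ m'.rev := fun hrev => hm (Fin.rev_inj.1 (Fin.ext hrev))
        simpa [blockDiagonal_apply, hm] using h.hasTimeAverage_of_ne j j' hrev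
    · simpa using (h.mean j).nat_add _
    · simpa using (h.mean j').nat_add _
    · exact absurd rfl hne
  diag := by
    rintro (⟨j, m⟩ | _)
    · simpa using (h.moments.diag j).nat_add _
    · intro r hr
      refine .of_forall fun N => (mul_nonpos_of_nonpos_of_nonneg hr.le N.cast_nonneg).trans ?_
      exact Finset.sum_nonneg fun n _ => sq_nonneg _

variable [Fintype J] {ι : Type*} [Fintype ι]

theorem IsWhite.exists_forall_mul_le (h : IsWhite ξ C) {M : ℕ}
    (A : (ι → ℝ) →ₗ[ℝ] (J × Fin M → ℝ)) (r : (ι → ℝ) →ₗ[ℝ] ℝ)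
    (hpos : ∀ x ≠ 0, 0 < ∑ m, (fun j => A x (j, m)) ⬝ᵥ C *ᵥ fun j => A x (j, m)) :
    ∃ κ : ℝ, 0 < κ ∧ ∀ᶠ N : ℕ in atTop, ∀ x, κ * N * (x ⬝ᵥ x) ≤ ∑ n ∈ Finset.range N,
      (∑ j, ∑ m, A x (j, m) * ξ j (n + m.rev) + r x) ^ 2 := by
  let L : (ι → ℝ) →ₗ[ℝ] (J × Fin M ⊕ Unit → ℝ) :=
    LinearMap.pi (Sum.elim (fun jm => LinearMap.proj jm ∘ₗ A) fun _ => r)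
  have hL : ∀ x, L x = Sum.elim (A x) fun _ => r x := fun x => by
    ext (_ | _) <;> rfl
  have hform : ∀ x, L x ⬝ᵥ fromBlocks (blockDiagonal fun _ => C) 0 0 0 *ᵥ L x =
      ∑ m, (fun j => A x (j, m)) ⬝ᵥ C *ᵥ fun j => A x (j, m) := fun x => by
    rw [hL, fromBlocks_mulVec]
    simp [dotProduct, mulVec, blockDiagonal_apply, Fintype.sum_prod_type_right]
  obtain ⟨κ, hκ, hev⟩ := (h.hasTimeMoments_lagged M).exists_forall_mul_le L
    fun x hx => (hpos x hx).trans_eq (hform x).symm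
  refine ⟨κ, hκ, hev.mono fun N hN x => (hN x).trans_eq ?_⟩
  refine Finset.sum_congr rfl fun n _ => congrArg (· ^ 2) ?_
  simp [hL, dotProduct, Fintype.sum_prod_type]

end WhiteNoise

section FilteredExcitation

variable {p : ℕ}

theorem sum_range_add_le_sum_Icc {f : ℕ → ℝ} (hf : ∀ n, 0 ≤ f n) {m K : ℕ} (hm : 1 ≤ m)
    (hmK : m ≤ K) (N : ℕ) :
    ∑ n ∈ Finset.range N, f (n + m) ≤ ∑ k ∈ Finset.Icc 1 (N + K), f k := by
  rw [Finset.range_eq_Ico, Finset.sum_Ico_add']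
  refine Finset.sum_le_sum_of_subset_of_nonneg (fun k hk => ?_) fun k _ _ => hf k
  simp only [Finset.mem_Ico, Finset.mem_Icc] at hk ⊢
  lia

theorem sub_sum_mul_sq_le (a t : Fin p → ℝ) (r : ℝ) :
    (r - ∑ i, a i * t i) ^ 2 ≤ 2 * r ^ 2 + 2 * (∑ i, a i ^ 2) * ∑ i, t i ^ 2 := by
  have hcauchy := Finset.sum_mul_sq_le_sq_mul_sq Finset.univ a t
  have hsplit := add_sq_le (a := r) (b := -∑ i, a i * t i)
  rw [← sub_eq_add_neg, neg_sq] at hsplit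
  linarith

theorem sum_sq_filtered_le (a : Fin p → ℝ) {K : ℕ} (hK : p + 1 ≤ K) (t : ℕ → ℝ) (N : ℕ) :
    ∑ n ∈ Finset.range N, (t (n + K) - ∑ i : Fin p, a i * t (n + K - (i + 1))) ^ 2 ≤
      (2 + 2 * (∑ i, a i ^ 2) * p) * ∑ k ∈ Finset.Icc 1 (N + K), t k ^ 2 := by
  set T : ℝ := ∑ k ∈ Finset.Icc 1 (N + K), t k ^ 2
  have : 0 ≤ ∑ i, a i ^ 2 := Finset.sum_nonneg fun _ _ => sq_nonneg _
  have hT : ∑ n ∈ Finset.range N, t (n + K) ^ 2 ≤ T :=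
    sum_range_add_le_sum_Icc (f := fun k => t k ^ 2) (fun _ => sq_nonneg _) (by lia) le_rfl N
  have hTlag : ∀ i : Fin p, ∑ n ∈ Finset.range N, t (n + K - (i + 1)) ^ 2 ≤ T := fun i => by
    simp only [fun n => Nat.add_sub_assoc (show (i : ℕ) + 1 ≤ K by lia) n]
    exact sum_range_add_le_sum_Icc (f := fun k => t k ^ 2) (fun _ => sq_nonneg _) (by lia)
      (Nat.sub_le _ _) N
  calc ∑ n ∈ Finset.range N, (t (n + K) - ∑ i : Fin p, a i * t (n + K - (i + 1))) ^ 2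
      ≤ ∑ n ∈ Finset.range N,
          (2 * t (n + K) ^ 2 + 2 * (∑ i, a i ^ 2) * ∑ i : Fin p, t (n + K - (i + 1)) ^ 2) :=
        Finset.sum_le_sum fun n _ => sub_sum_mul_sq_le a _ _
    _ = 2 * ∑ n ∈ Finset.range N, t (n + K) ^ 2 + 2 * (∑ i, a i ^ 2) *
          ∑ i : Fin p, ∑ n ∈ Finset.range N, t (n + K - (i + 1)) ^ 2 := by
        rw [Finset.sum_add_distrib, ← Finset.mul_sum, ← Finset.mul_sum, Finset.sum_comm]
    _ ≤ 2 * T + 2 * (∑ i, a i ^ 2) * ∑ _i : Fin p, T := by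
        gcongr with i
        exact hTlag i
    _ = (2 + 2 * (∑ i, a i ^ 2) * p) * T := by
        rw [Finset.sum_const, Finset.card_univ, Fintype.card_fin, nsmul_eq_mul]
        ring

theorem persistentlyExciting_of_filtered {ι : Type*} [Fintype ι] (a : Fin p → ℝ) {K : ℕ}
    (hK : p + 1 ≤ K) {φ : ℕ → ι → ℝ} {κ : ℝ} (hκ : 0 < κ)
    (h : ∀ᶠ N : ℕ in atTop, ∀ x : ι → ℝ, κ * N * (x ⬝ᵥ x) ≤ ∑ n ∈ Finset.range N,
      (x ⬝ᵥ φ (n + K) - ∑ i : Fin p, a i * (x ⬝ᵥ φ (n + K - (i + 1)))) ^ 2) :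
    PersistentlyExciting φ := by
  have : 0 ≤ ∑ i, a i ^ 2 := Finset.sum_nonneg fun _ _ => sq_nonneg _
  set B : ℝ := 2 + 2 * (∑ i, a i ^ 2) * p
  have hB0 : 0 < B := by positivity
  refine ⟨κ / 2 / B, by positivity, ?_⟩
  filter_upwards [(tendsto_sub_atTop_nat K).eventually h, eventually_ge_atTop (2 * K)]
    with N hN hN2 x
  have hle := (hN x).trans (sum_sq_filtered_le a hK (fun k => x ⬝ᵥ φ k) (N - K))
  rw [Nat.sub_add_cancel (by lia), Nat.cast_sub (by lia)] at hle
  have hhalf : (N : ℝ) / 2 ≤ N - K := by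
    have : (2 * K : ℝ) ≤ N := by exact_mod_cast hN2
    linarith
  have hx : 0 ≤ x ⬝ᵥ x := (sq_nonneg _).trans (norm_sq_le_dotProduct_self x)
  calc κ / 2 / B * N * (x ⬝ᵥ x) = κ * (N / 2) * (x ⬝ᵥ x) / B := by ring
    _ ≤ κ * (N - K) * (x ⬝ᵥ x) / B := by gcongr
    _ ≤ _ := (div_le_iff₀' hB0).2 hle

end FilteredExcitation

section HammersteinExcitation

open Polynomial

variable {p q s : ℕ} {a : Fin p → ℝ} {b : Fin q → ℝ} {d : Fin s → ℝ} {g : Fin s → ℝ → ℝ}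
  {y u : ℤ → ℝ} {w : ℕ → ℝ} {κ : ℝ} {Cov : Matrix (Fin s) (Fin s) ℝ}

theorem dotProduct_fromBlocks_mulVec_self (v : Unit ⊕ Fin s → ℝ) :
    v ⬝ᵥ fromBlocks (diagonal fun _ => κ) 0 0 Cov *ᵥ v =
      κ * v (Sum.inl ()) ^ 2 + (v ∘ Sum.inr) ⬝ᵥ Cov *ᵥ (v ∘ Sum.inr) := by
  simp only [fromBlocks_mulVec, dotProduct, Fintype.sum_sum_type, Finset.univ_unique,
    Finset.sum_singleton, Sum.elim_inl, Sum.elim_inr, zero_mulVec, mulVec_diagonal,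
    Function.comp_apply, add_zero, zero_add]
  ring

theorem coeff_channelPoly_eq_zero_iff {x : Fin p ⊕ (Fin q × Fin s) → ℝ} {c : Unit ⊕ Fin s} :
    (∀ m : Fin (p + q + 2), (channelPoly a b d x c).coeff m = 0) ↔ channelPoly a b d x c = 0 := by
  refine ⟨fun h => Polynomial.ext fun m => ?_, fun h m => by rw [h, coeff_zero]⟩
  rcases lt_or_ge m (p + q + 2) with hm | hm
  · exact h ⟨m, hm⟩
  · exact coeff_eq_zero_of_natDegree_lt ((natDegree_channelPoly_le x c).trans_lt hm)

theorem sum_coeff_channelPoly_pos (hκ : 0 ≤ κ) (hCov : Cov.PosDef)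
    (hnondeg : 0 < κ ∨ MinimalSystem a b d) {x : Fin p ⊕ (Fin q × Fin s) → ℝ} (hx : x ≠ 0) :
    0 < ∑ m : Fin (p + q + 2), (fun c => (channelPoly a b d x c).coeff m) ⬝ᵥ
      fromBlocks (diagonal fun _ => κ) 0 0 Cov *ᵥ fun c => (channelPoly a b d x c).coeff m := by
  simp only [dotProduct_fromBlocks_mulVec_self]
  have hnoise : ∀ m : Fin (p + q + 2), 0 ≤ κ * (channelPoly a b d x (Sum.inl ())).coeff m ^ 2 :=
    fun m => by positivity
  have hinput := fun v : Fin s → ℝ => hCov.posSemidef.dotProduct_mulVec_nonneg v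
  refine (Finset.sum_nonneg fun m _ => add_nonneg (hnoise m) (hinput _)).lt_of_ne' fun h0 => hx ?_
  rw [Finset.sum_eq_zero_iff_of_nonneg fun m _ => add_nonneg (hnoise m) (hinput _)] at h0
  have hzero := fun m =>
    (add_eq_zero_iff_of_nonneg (hnoise m) (hinput _)).1 (h0 m (Finset.mem_univ m))
  have hinr : ∀ j, channelPoly a b d x (Sum.inr j) = 0 := fun j => by
    refine coeff_channelPoly_eq_zero_iff.1 fun m => ?_
    by_contra hne
    exact (hCov.dotProduct_mulVec_pos fun hv => hne (congrFun hv j)).ne' (hzero m).2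
  rcases hnondeg with hκ | hmin
  · refine eq_zero_of_channelPoly_eq_zero (a := a) (b := b) (d := d) (funext ?_)
    rintro (_ | j)
    · exact coeff_channelPoly_eq_zero_iff.1 fun m => by simpa [hκ.ne'] using (hzero m).1
    · exact hinr j
  · exact hmin.eq_zero_of_channelPoly_inr_eq_zero hinr

theorem IsHammersteinPath.persistentlyExciting (h : IsHammersteinPath a b d g y u w)
    (hκ : 0 ≤ κ) (hCov : Cov.PosDef) (mean : Unit ⊕ Fin s → ℝ)
    (hwhite : IsWhite (fun c n => drivingSignal g u w c (n + 1) - mean c)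
      (fromBlocks (diagonal fun _ => κ) 0 0 Cov))
    (hnondeg : 0 < κ ∨ MinimalSystem a b d) :
    PersistentlyExciting (hammersteinRegressor p q g y u) := by
  obtain ⟨κ', hκ', hev⟩ := hwhite.exists_forall_mul_le (M := p + q + 2)
    (LinearMap.pi fun cm => lcoeff ℝ cm.2 ∘ₗ LinearMap.proj cm.1 ∘ₗ channelPoly a b d)
    (∑ c, mean c • (leval 1 ∘ₗ LinearMap.proj c ∘ₗ channelPoly a b d))
    fun x hx => sum_coeff_channelPoly_pos hκ hCov hnondeg hx
  refine persistentlyExciting_of_filtered a (K := p + q + 2) (by lia) hκ' ?_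
  refine hev.mono fun N hN x => (hN x).trans_eq <| Finset.sum_congr rfl fun n _ => ?_
  have hlag : ∀ m : Fin (p + q + 2),
      ((n + (p + q + 2) : ℕ) : ℤ) - (m : ℕ) = ((n + m.rev : ℕ) : ℤ) + 1 := fun m => by
    have := m.2
    rw [Fin.val_rev]
    lia
  have heval : ∀ c, (channelPoly a b d x c).eval 1 =
      ∑ m : Fin (p + q + 2), (channelPoly a b d x c).coeff m := fun c => by
    rw [eval_eq_sum_range' (Nat.lt_succ_of_le (natDegree_channelPoly_le x c)), Finset.sum_range]
    simp only [one_pow, mul_one]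
  rw [h.filtered_dotProduct x (by lia)]
  simp only [aeval_backshift_apply (Nat.lt_succ_of_le (natDegree_channelPoly_le x _)),
    Finset.sum_range, hlag]
  simp only [LinearMap.pi_apply, LinearMap.comp_apply, LinearMap.proj_apply, lcoeff_apply,
    LinearMap.sum_apply, LinearMap.smul_apply, smul_eq_mul, leval_apply, heval, mul_sub,
    Finset.sum_sub_distrib, ← Finset.sum_mul, mul_comm (mean _), sub_add_cancel]

end HammersteinExcitation

section Covariance

variable {E : Type*} [MeasurableSpace E] {J : Type*} {μ : Measure E} {g : J → E → ℝ}

/-- The covariance matrix of a family of functions under the law `μ`. -/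
noncomputable def covarianceMatrix (μ : Measure E) (g : J → E → ℝ) : Matrix J J ℝ :=
  .of fun j j' => cov[g j, g j'; μ]

variable [Fintype J]

/-- No nontrivial linear combination of the functions `g j` is `μ`-almost everywhere constant. -/
def IndependentModConst (μ : Measure E) (g : J → E → ℝ) : Prop :=
  ∀ (c₀ : ℝ) (c : J → ℝ), (∀ᵐ x ∂μ, c₀ + ∑ j, c j * g j x = 0) → c = 0

theorem dotProduct_covarianceMatrix_mulVec_self [IsFiniteMeasure μ] (hg : ∀ j, MemLp (g j) 2 μ)
    (c : J → ℝ) : c ⬝ᵥ covarianceMatrix μ g *ᵥ c = Var[fun x => ∑ j, c j * g j x; μ] := by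
  have hcg : ∀ j, MemLp (fun x => c j * g j x) 2 μ := fun j => (hg j).const_mul _
  rw [← covariance_self (memLp_finsetSum _ fun j _ => hcg j).aemeasurable,
    covariance_fun_sum_fun_sum hcg hcg]
  simp only [dotProduct, mulVec, covarianceMatrix, Matrix.of_apply, covariance_const_mul_left,
    covariance_const_mul_right, Finset.mul_sum]
  simp only [mul_comm, mul_left_comm]

theorem IndependentModConst.posDef_covarianceMatrix [IsFiniteMeasure μ]
    (hind : IndependentModConst μ g) (hg : ∀ j, MemLp (g j) 2 μ) :
    (covarianceMatrix μ g).PosDef := by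
  refine .of_dotProduct_mulVec_pos (Matrix.ext fun j j' => covariance_comm _ _) fun {c} hc => ?_
  rw [star_trivial, dotProduct_covarianceMatrix_mulVec_self hg]
  refine (variance_nonneg _ _).lt_of_ne' fun hvar => hc ?_
  refine hind (-∫ x, ∑ j, c j * g j x ∂μ) c ?_
  filter_upwards [ae_eq_integral_of_variance_eq_zero
    (memLp_finsetSum _ fun j _ => (hg j).const_mul (c j)) hvar] with x hx
  rw [hx, neg_add_cancel]

theorem restrict_absolutelyContinuous_withDensity {ν : Measure E} {dens : E → ℝ}
    (hdens : Measurable dens) {A : Set E} (hA : MeasurableSet A) (hpos : ∀ x ∈ A, 0 < dens x) :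
    ν.restrict A ≪ ν.withDensity fun x => ENNReal.ofReal (dens x) := by
  refine (withDensity_absolutelyContinuous' hdens.ennreal_ofReal.aemeasurable ?_).trans ?_
  · exact (ae_restrict_iff' hA).2 (ae_of_all _ fun x hx => (ENNReal.ofReal_pos.2 (hpos x hx)).ne')
  · rw [← restrict_withDensity hA]
    exact Measure.absolutelyContinuous_of_le Measure.restrict_le_self

theorem BasisIndependentOn.independentModConst {s : ℕ} {g : Fin s → ℝ → ℝ} {lo hi : ℝ}
    {μ : Measure ℝ} (hbasis : BasisIndependentOn g lo hi)
    (hμ : volume.restrict (Set.Icc lo hi) ≪ μ) : IndependentModConst μ g :=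
  fun c₀ c h => (hbasis c₀ c (hμ.ae_le h)).2

end Covariance

section WhiteMartingaleDifferences

open Asymptotics

variable {Ω : Type*} {mΩ : MeasurableSpace Ω} {P : Measure Ω} {ℱ : Filtration ℕ mΩ}
  {D a : ℕ → Ω → ℝ}

theorem hasTimeAverage_zero_of_isBigO {t : ℕ → ℝ} {α : ℝ} (hα : α < 1)
    (h : (fun N => ∑ n ∈ Finset.range N, t n) =O[atTop] fun N : ℕ => (N : ℝ) ^ α) :
    HasTimeAverage t 0 := by
  have hlin : (fun N => ∑ n ∈ Finset.range N, t n) =o[atTop] fun N : ℕ => (N : ℝ) := by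
    simpa only [Real.rpow_one] using h.trans_isLittleO (isLittleO_natCast_rpow_of_lt hα)
  exact hlin.tendsto_div_nhds_zero

namespace IsBoundedVarianceMDS

variable [IsProbabilityMeasure P]

theorem ae_hasTimeAverage_mul (hD : IsBoundedVarianceMDS P ℱ D)
    (ha : ∀ n, Measurable[ℱ n] (a n)) (hsum : ∀ᵐ ω ∂P, WeightedSqSummable (3 / 2) (a · ω)) :
    ∀ᵐ ω ∂P, HasTimeAverage (fun n => a n ω * D n ω) 0 := by
  filter_upwards [hD.ae_isBigO_sum_mul (α := 3 / 2) (by norm_num) ha, hsum] with ω hω hsum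
  exact hasTimeAverage_zero_of_isBigO (by norm_num) (hω hsum)

theorem ae_hasTimeAverage (hD : IsBoundedVarianceMDS P ℱ D) :
    ∀ᵐ ω ∂P, HasTimeAverage (D · ω) 0 := by
  simpa only [one_mul] using hD.ae_hasTimeAverage_mul (a := fun _ _ => 1)
    (fun n => measurable_const) (ae_of_all _ fun _ => weightedSqSummable_const (by norm_num) 1)

theorem ae_hasTimeAverage_mul_lag (hD : IsBoundedVarianceMDS P ℱ D)
    (ha : ∀ n, Measurable[ℱ (n + 1)] (a n)) (hsum : ∀ᵐ ω ∂P, WeightedSqSummable (3 / 2) (a · ω))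
    (k : ℕ) : ∀ᵐ ω ∂P, HasTimeAverage (fun n => a n ω * D (n + (k + 1)) ω) 0 := by
  let a' : ℕ → Ω → ℝ := fun m => if k + 1 ≤ m then a (m - (k + 1)) else 0
  have ha' : ∀ n, a' (n + (k + 1)) = a n := fun n => by
    simp only [a', le_add_iff_nonneg_left, zero_le, if_true, Nat.add_sub_cancel]
  have hmeas : ∀ m, Measurable[ℱ m] (a' m) := fun m => by
    rcases lt_or_ge m (k + 1) with hm | hm
    · simpa only [a', not_le.2 hm, if_false] using @measurable_zero _ _ _ (ℱ m) _
    · obtain ⟨n, rfl⟩ := Nat.exists_eq_add_of_le' hm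
      rw [ha']
      exact (ha n).mono (ℱ.mono (by lia)) le_rfl
  have hsum' : ∀ᵐ ω ∂P, WeightedSqSummable (3 / 2) (a' · ω) := hsum.mono fun ω hω => by
    rw [← weightedSqSummable_nat_add_iff (by norm_num) (k + 1)]
    simpa only [ha'] using hω
  filter_upwards [hD.ae_hasTimeAverage_mul hmeas hsum'] with ω hω
  simpa only [ha'] using hω.nat_add (k + 1)

end IsBoundedVarianceMDS

theorem ofReal_sq_le_one_add_ofReal_rpow {γ : ℝ} (hγ : 2 ≤ γ) (x : ℝ) :
    ENNReal.ofReal (x ^ 2) ≤ 1 + ENNReal.ofReal (|x| ^ γ) := by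
  rw [← ENNReal.ofReal_one, ← ENNReal.ofReal_add zero_le_one (by positivity)]
  refine ENNReal.ofReal_le_ofReal ?_
  rcases le_total |x| 1 with hx | hx
  · linarith [(sq_le_one_iff_abs_le_one x).2 hx, Real.rpow_nonneg (abs_nonneg x) γ]
  · have hpow := Real.rpow_le_rpow_of_exponent_le hx hγ
    rw [Real.rpow_two, sq_abs] at hpow
    linarith

theorem MartingaleDifferenceNoise.isBoundedVarianceMDS [IsProbabilityMeasure P] {w : ℕ → Ω → ℝ}
    (hw : MartingaleDifferenceNoise P ℱ w) :
    IsBoundedVarianceMDS P (shiftFiltration ℱ 1) fun n => w (n + 2) := by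
  obtain ⟨hmeas, hint, γ, hγ, hsup⟩ := hw
  refine ⟨fun n => hmeas (n + 2) (by lia), fun n => (hint (n + 1) (by lia)).1,
    fun n => (hint (n + 1) (by lia)).2, ?_⟩
  have hle : ∀ n, P⁻[fun ω' => ENNReal.ofReal (w (n + 2) ω' ^ 2) | ℱ (n + 1)] ≤ᵐ[P]
      fun ω => 1 + P⁻[fun ω' => ENNReal.ofReal (|w (n + 2) ω'| ^ γ) | ℱ (n + 1)] ω := fun n => by
    have hmono := condLExp_mono (mΩ := ℱ (n + 1)) (P := P) (ae_of_all P fun ω =>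
      ofReal_sq_le_one_add_ofReal_rpow hγ.le (w (n + 2) ω))
    refine hmono.trans_eq <| (condLExp_add_left _ aemeasurable_const).trans ?_
    rw [condLExp_const (ℱ.le _)]
    rfl
  filter_upwards [hsup, ae_all_iff.2 hle] with ω hω hle
  refine (iSup_le fun n => ?_).trans_lt (ENNReal.add_lt_top.2 ⟨ENNReal.one_lt_top, hω⟩)
  refine (hle n).trans (add_le_add_right ?_ _)
  exact le_iSup₂ (f := fun (k : ℕ) (_ : 1 ≤ k) =>
    P⁻[fun ω' => ENNReal.ofReal (|w (k + 1) ω'| ^ γ) | ℱ k] ω) (n + 1) (by lia)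

end WhiteMartingaleDifferences

section ExogenousInput

open scoped ENNReal

variable {Ω : Type*} {mΩ : MeasurableSpace Ω} {P : Measure Ω}

theorem indepFun_prodMk_right_of_prodMk_left {α β γ : Type*} [MeasurableSpace α]
    [MeasurableSpace β] [MeasurableSpace γ] [IsProbabilityMeasure P] {X : Ω → α} {Y : Ω → β}
    {Z : Ω → γ} (hX : Measurable X) (hY : Measurable Y) (hZ : Measurable Z)
    (hXY : IndepFun X Y P) (hXYZ : IndepFun (fun ω => (X ω, Y ω)) Z P) :
    IndepFun X (fun ω => (Y ω, Z ω)) P := by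
  have hYZ : IndepFun Y Z P := hXYZ.comp measurable_snd measurable_id
  rw [indepFun_iff_map_prod_eq_prod_map_map (by fun_prop) (by fun_prop)] at hXY hXYZ hYZ ⊢
  rw [hYZ, ← Measure.prodAssoc_prod, ← hXY, ← hXYZ,
    Measure.map_map MeasurableEquiv.prodAssoc.measurable (by fun_prop)]
  rfl

variable {E F : Type*} [MeasurableSpace E] [MeasurableSpace F] {μ : Measure E} {U : ℕ → Ω → E}
  {V : Ω → F}

/-- The values `U 0, …, U (n - 1)` of the input before time `n`, together with the variable `V`. -/
def inputHistory (U : ℕ → Ω → E) (V : Ω → F) (n : ℕ) (ω : Ω) : (Finset.range n → E) × F :=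
  (fun k => U k ω, V ω)

/-- The filtration generated by `V` and the past of the input. The whole of `V` is known from the
start. -/
def inputFiltration (hU : ∀ n, Measurable (U n)) (hV : Measurable V) : Filtration ℕ mΩ where
  seq n := .comap (inputHistory U V n) inferInstance
  mono' m n h := by
    have hrestrict : Measurable fun x : (Finset.range n → E) × F =>
        (fun k : Finset.range m => x.1 ⟨k, Finset.range_mono h k.2⟩, x.2) := by fun_prop
    exact (hrestrict.comp (comap_measurable (inputHistory U V n))).comap_le
  le' n := Measurable.comap_le (by unfold inputHistory; fun_prop)

theorem measurable_inputFiltration_input (hU : ∀ n, Measurable (U n)) (hV : Measurable V) (n : ℕ) :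
    Measurable[inputFiltration hU hV (n + 1)] (U n) := by
  have heval : Measurable fun x : (Finset.range (n + 1) → E) × F =>
      x.1 ⟨n, Finset.self_mem_range_succ n⟩ := by fun_prop
  exact heval.comp (comap_measurable (inputHistory U V (n + 1)))

theorem measurable_inputFiltration_exogenous (hU : ∀ n, Measurable (U n)) (hV : Measurable V)
    (n : ℕ) : Measurable[inputFiltration hU hV n] V :=
  (measurable_snd (α := Finset.range n → E)).comp (comap_measurable (inputHistory U V n))

theorem measurable_inputFiltration_exogenous_apply (hU : ∀ n, Measurable (U n))
    {v : ℕ → Ω → ℝ} (hv : Measurable fun ω n => v n ω) (m n : ℕ) :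
    Measurable[inputFiltration hU hv m] (v n) :=
  (measurable_pi_apply (X := fun _ => ℝ) n).comp (measurable_inputFiltration_exogenous hU hv m)

/-- The inputs `U n` are independent with common law `μ`, and jointly independent of `V`. -/
structure IsExogenousIID (P : Measure Ω) (μ : Measure E) (U : ℕ → Ω → E) (V : Ω → F) :
    Prop where
  measurable_input : ∀ n, Measurable (U n)
  measurable_exogenous : Measurable V
  map_eq : ∀ n, P.map (U n) = μ
  independent : iIndepFun U P
  indepFun : IndepFun (fun ω n => U n ω) V P

/-- The signals that drive the system, at one outcome: the noise `v` (index `inl ()`) and the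
centered basis functions of the input (index `inr j`). -/
noncomputable def innovationSignal {J : Type*} (μ : Measure E) (g : J → E → ℝ) (U : ℕ → Ω → E)
    (v : ℕ → Ω → ℝ) (ω : Ω) : Unit ⊕ J → ℕ → ℝ :=
  Sum.elim (fun _ n => v n ω) fun j n => g j (U n ω) - μ[g j]

namespace IsExogenousIID

theorem measurePreserving (h : IsExogenousIID P μ U V) (n : ℕ) : MeasurePreserving (U n) P μ :=
  ⟨h.measurable_input n, h.map_eq n⟩

variable {f f' : E → ℝ}

theorem ae_hasTimeAverage (h : IsExogenousIID P μ U V) (hf : Measurable f)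
    (hint : Integrable f μ) : ∀ᵐ ω ∂P, HasTimeAverage (fun n => f (U n ω)) μ[f] := by
  have hmean : ∫ ω, f (U 0 ω) ∂P = μ[f] := by
    rw [← h.map_eq 0, integral_map (h.measurable_input 0).aemeasurable hf.aestronglyMeasurable]
  rw [← hmean]
  refine strong_law_ae_real (fun n ω => f (U n ω)) ?_ (fun i j hij => ?_) fun n => ?_
  · exact (h.measurePreserving 0).integrable_comp_of_integrable hint
  · exact (h.independent.indepFun hij).comp hf hf
  · exact IdentDistrib.comp ⟨(h.measurable_input n).aemeasurable,
      (h.measurable_input 0).aemeasurable, by rw [h.map_eq, h.map_eq]⟩ hf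

variable [IsProbabilityMeasure P]

theorem isProbabilityMeasure (h : IsExogenousIID P μ U V) : IsProbabilityMeasure μ := by
  rw [← h.map_eq 0]
  exact Measure.isProbabilityMeasure_map (h.measurable_input 0).aemeasurable

theorem indep_inputFiltration (h : IsExogenousIID P μ U V) (n : ℕ) :
    Indep (.comap (U n) inferInstance)
      (inputFiltration h.measurable_input h.measurable_exogenous n) P := by
  have hU := h.measurable_input
  have hpast : IndepFun (U n) (fun ω (k : Finset.range n) => U k ω) P :=
    (h.independent.indepFun_finset {n} (Finset.range n) (by simp) hU).comp
      (measurable_pi_apply (⟨n, Finset.mem_singleton_self n⟩ : ({n} : Finset ℕ))) measurable_id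
  have hjoint : IndepFun (fun ω => (U n ω, fun k : Finset.range n => U k ω)) V P :=
    h.indepFun.comp (φ := fun x => (x n, fun k : Finset.range n => x k)) (by fun_prop)
      measurable_id
  exact indepFun_prodMk_right_of_prodMk_left (hU n) (by fun_prop) h.measurable_exogenous hpast
    hjoint

theorem isBoundedVarianceMDS (h : IsExogenousIID P μ U V) (hf : Measurable f)
    (hf2 : MemLp f 2 μ) :
    IsBoundedVarianceMDS P (inputFiltration h.measurable_input h.measurable_exogenous)
      fun n ω => f (U n ω) - μ[f] := by
  have hL2 : ∀ n, MemLp (fun ω => f (U n ω) - μ[f]) 2 P := fun n =>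
    (hf2.comp_measurePreserving (h.measurePreserving n)).sub (memLp_const _)
  have hmeas : ∀ n, Measurable[.comap (U n) inferInstance] fun ω => f (U n ω) - μ[f] := fun n =>
    (hf.sub_const _).comp (comap_measurable _)
  have hint : ∀ n, Integrable (fun ω => f (U n ω)) P := fun n =>
    (hf2.comp_measurePreserving (h.measurePreserving n)).integrable one_le_two
  refine ⟨fun n => (hf.sub_const _).comp (measurable_inputFiltration_input _ _ n),
    fun n => (hL2 n).integrable one_le_two, fun n => ?_, ?_⟩
  · refine (condExp_indep_eq (h.measurable_input n).comap_le (Filtration.le _ n)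
      (hmeas n).stronglyMeasurable (h.indep_inputFiltration n)).trans (ae_of_all _ fun ω => ?_)
    rw [integral_sub (hint n) (integrable_const _), ← h.map_eq n,
      integral_map (h.measurable_input n).aemeasurable hf.aestronglyMeasurable]
    simp
  · have hcond := fun n => condLExp_of_indep (h.measurable_input n).comap_le
      (Filtration.le _ n) (h.indep_inputFiltration n) ((hmeas n).pow_const 2).ennreal_ofReal
    have hlaw : ∀ n, ∫⁻ ω, ENNReal.ofReal ((f (U n ω) - μ[f]) ^ 2) ∂P =
        ∫⁻ x, ENNReal.ofReal ((f x - μ[f]) ^ 2) ∂μ := fun n =>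
      (h.measurePreserving n).lintegral_comp ((hf.sub_const _).pow_const 2).ennreal_ofReal
    filter_upwards [ae_all_iff.2 hcond] with ω hω
    simp only [hω, hlaw, ciSup_const]
    have := h.isProbabilityMeasure
    exact (hf2.sub (memLp_const _)).integrable_sq.lintegral_lt_top

theorem ae_hasTimeAverage_covariance (h : IsExogenousIID P μ U V) (hf : Measurable f)
    (hf' : Measurable f') (hf2 : MemLp f 2 μ) (hf2' : MemLp f' 2 μ) :
    ∀ᵐ ω ∂P, HasTimeAverage (fun n => (f (U n ω) - μ[f]) * (f' (U n ω) - μ[f'])) cov[f, f'; μ] :=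
  have := h.isProbabilityMeasure
  h.ae_hasTimeAverage ((hf.sub_const _).mul (hf'.sub_const _))
    ((hf2.sub (memLp_const _)).integrable_mul (hf2'.sub (memLp_const _)))

variable {J : Type*} {g : J → E → ℝ} {v : ℕ → Ω → ℝ}

theorem ae_hasTimeAverage_mul_lag (h : IsExogenousIID P μ U fun ω n => v n ω)
    {ℱ : Filtration ℕ mΩ} (hv : IsBoundedVarianceMDS P ℱ v) (hg : ∀ j, Measurable (g j))
    (hg2 : ∀ j, MemLp (g j) 2 μ) (c c' : Unit ⊕ J) (k : ℕ) :
    ∀ᵐ ω ∂P, HasTimeAverage (fun n =>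
      innovationSignal μ g U v ω c n * innovationSignal μ g U v ω c' (n + (k + 1))) 0 := by
  have hU := fun j => h.isBoundedVarianceMDS (hg j) (hg2 j)
  have hvsum : ∀ᵐ ω ∂P, WeightedSqSummable (3 / 2) (v · ω) :=
    hv.ae_weightedSqSummable (by norm_num)
  have hmeas : ∀ m n, Measurable[inputFiltration h.measurable_input h.measurable_exogenous m]
      (v n) := measurable_inputFiltration_exogenous_apply _ h.measurable_exogenous
  rcases c with _ | j <;> rcases c' with _ | j' <;>
    simp only [innovationSignal, Sum.elim_inl, Sum.elim_inr]
  · exact hv.ae_hasTimeAverage_mul_lag hv.measurable hvsum k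
  · exact (hU j').ae_hasTimeAverage_mul_lag (fun n => hmeas (n + 1) n) hvsum k
  · simpa only [mul_comm] using (hU j).ae_hasTimeAverage_mul (a := fun n => v (n + (k + 1)))
      (fun n => hmeas n _) (hvsum.mono fun ω hω =>
        (weightedSqSummable_nat_add_iff (v := (v · ω)) (by norm_num) (k + 1)).2 hω)
  · exact (hU j').ae_hasTimeAverage_mul_lag (hU j).measurable
      ((hU j).ae_weightedSqSummable (by norm_num)) k

variable [Countable J]

theorem ae_forall_hasTimeMoments (h : IsExogenousIID P μ U fun ω n => v n ω)
    (hv : ∀ᵐ ω ∂P, WeightedSqSummable (3 / 2) (v · ω)) (hg : ∀ j, Measurable (g j))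
    (hg2 : ∀ j, MemLp (g j) 2 μ) :
    ∀ᵐ ω ∂P, ∀ κ, HasTimeAverageGE (fun n => v n ω ^ 2) κ →
      HasTimeMoments (innovationSignal μ g U v ω)
        (fromBlocks (diagonal fun _ => κ) 0 0 (covarianceMatrix μ g)) := by
  have hcross := fun j => (h.isBoundedVarianceMDS (hg j) (hg2 j)).ae_hasTimeAverage_mul
    (fun n => measurable_inputFiltration_exogenous_apply _ h.measurable_exogenous n n) hv
  have hcov := fun j j' => h.ae_hasTimeAverage_covariance (hg j) (hg j') (hg2 j) (hg2 j')
  filter_upwards [ae_all_iff.2 hcross, ae_all_iff.2 fun j => ae_all_iff.2 (hcov j)]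
    with ω hcross hcov κ hκ
  refine ⟨?_, ?_⟩
  · rintro (_ | j) (_ | j') hne
    · exact absurd rfl hne
    · exact hcross j'
    · simpa [innovationSignal, mul_comm] using hcross j
    · exact hcov j j'
  · rintro (_ | j)
    · simpa [innovationSignal] using hκ
    · simpa [innovationSignal, pow_two, covarianceMatrix] using (hcov j j).hasTimeAverageGE

theorem ae_forall_isWhite (h : IsExogenousIID P μ U fun ω n => v n ω) {ℱ : Filtration ℕ mΩ}
    (hv : IsBoundedVarianceMDS P ℱ v) (hg : ∀ j, Measurable (g j)) (hg2 : ∀ j, MemLp (g j) 2 μ) :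
    ∀ᵐ ω ∂P, ∀ κ, HasTimeAverageGE (fun n => v n ω ^ 2) κ →
      IsWhite (innovationSignal μ g U v ω)
        (fromBlocks (diagonal fun _ => κ) 0 0 (covarianceMatrix μ g)) := by
  have hmeanU := fun j => (h.isBoundedVarianceMDS (hg j) (hg2 j)).ae_hasTimeAverage
  have hlag := fun c c' => ae_all_iff.2 (h.ae_hasTimeAverage_mul_lag hv hg hg2 c c')
  filter_upwards [hv.ae_hasTimeAverage, ae_all_iff.2 hmeanU,
    ae_all_iff.2 fun c => ae_all_iff.2 (hlag c),
    h.ae_forall_hasTimeMoments (hv.ae_weightedSqSummable (by norm_num)) hg hg2]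
    with ω hmeanv hmeanU hlag hmoments κ hκ
  exact ⟨Sum.rec (fun _ => hmeanv) hmeanU, hlag, hmoments κ hκ⟩

end IsExogenousIID

end ExogenousInput

section HammersteinRegression

open Asymptotics

variable {p q s : ℕ} {a : Fin p → ℝ} {b : Fin q → ℝ} {d : Fin s → ℝ} {g : Fin s → ℝ → ℝ}

section Path

variable {y u : ℤ → ℝ} {w : ℕ → ℝ} {α : ℝ}

theorem weightedSqSummable_sub_iff (hα : 0 ≤ α) (t : ℤ → ℝ) (m : ℕ) :
    WeightedSqSummable α (fun n : ℕ => t (n - m)) ↔ WeightedSqSummable α fun n : ℕ => t n := by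
  rw [← weightedSqSummable_nat_add_iff hα m]
  simp only [Nat.cast_add, add_sub_cancel_right]

theorem IsHammersteinPath.weightedSqSummable_output (h : IsHammersteinPath a b d g y u w)
    (hstable : ∀ z : ℂ, ‖z‖ ≤ 1 → Polynomial.aeval z (arPoly a) ≠ 0) (hα : 0 ≤ α)
    (hw : WeightedSqSummable α w) (hu : ∀ j, WeightedSqSummable α fun n : ℕ => g j (u n)) :
    WeightedSqSummable α fun n : ℕ => y n := by
  refine weightedSqSummable_of_aeval_backshift hα hstable ?_
  have hinput : WeightedSqSummable α fun n : ℕ => ∑ j, d j *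
      Polynomial.aeval (backshift ℝ) (Polynomial.X * inputPoly b) (fun k => g j (u k)) n := by
    refine WeightedSqSummable.sum _ fun j _ => WeightedSqSummable.const_mul ?_ _
    simp only [aeval_backshift_apply (Nat.lt_succ_self _)]
    exact WeightedSqSummable.sum _ fun m _ => WeightedSqSummable.const_mul
      ((weightedSqSummable_sub_iff hα (fun k => g j (u k)) m).2 (hu j)) _
  refine (weightedSqSummable_congr ?_).2 (hinput.add hw)
  filter_upwards [eventually_ge_atTop 2] with n hn
  have hsub := h.aeval_arPoly_sub (k := n) (by exact_mod_cast hn)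
  simp only [Pi.sub_apply, Finset.sum_apply, Pi.smul_apply, smul_eq_mul] at hsub
  rw [sub_eq_iff_eq_add] at hsub
  simp only [drivingSignal, Sum.elim_inl, Sum.elim_inr, sub_add_cancel, Int.toNat_natCast] at hsub
  rw [hsub, add_comm]

theorem IsHammersteinPath.weightedSqSummable_regressor (h : IsHammersteinPath a b d g y u w)
    (hstable : ∀ z : ℂ, ‖z‖ ≤ 1 → Polynomial.aeval z (arPoly a) ≠ 0) (hα : 0 ≤ α)
    (hw : WeightedSqSummable α w) (hu : ∀ j, WeightedSqSummable α fun n : ℕ => g j (u n))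
    (l : Fin p ⊕ (Fin q × Fin s)) :
    WeightedSqSummable α fun n : ℕ => hammersteinRegressor p q g y u n l := by
  rcases l with i | ⟨i, j⟩
  · exact (weightedSqSummable_sub_iff hα y i).2 (h.weightedSqSummable_output hstable hα hw hu)
  · exact (weightedSqSummable_sub_iff hα (fun k => g j (u k)) i).2 (hu j)

/-- The over-parametrised parameter vector `θ`, with the entries `a_i` and `b_i d_j`. -/
def hammersteinParameter (a : Fin p → ℝ) (b : Fin q → ℝ) (d : Fin s → ℝ) :
    Fin p ⊕ (Fin q × Fin s) → ℝ :=
  Sum.elim a fun ij => b ij.1 * d ij.2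

theorem IsHammersteinPath.nextOutput_eq (h : IsHammersteinPath a b d g y u w) {k : ℕ}
    (hk : 1 ≤ k) :
    nextOutput y k =
      hammersteinParameter a b d ⬝ᵥ hammersteinRegressor p q g y u k + w (k + 1) := by
  rw [nextOutput, h k hk]
  simp only [hammersteinParameter, hammersteinRegressor, dotProduct, Fintype.sum_sum_type,
    Fintype.sum_prod_type, Sum.elim_inl, Sum.elim_inr, Finset.mul_sum, mul_assoc]

theorem zeroColumns_eq_of_forall_eq_zero_iff (hb : ∑ i, b i ^ 2 ≠ 0)
    {β : Fin p ⊕ (Fin q × Fin s) → ℝ} (hβ : ∀ l, β l = 0 ↔ hammersteinParameter a b d l = 0) :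
    zeroColumns β = {l | d l = 0} := by
  obtain ⟨i, -, hi⟩ := Finset.exists_ne_zero_of_sum_ne_zero hb
  have hi : b i ≠ 0 := pow_ne_zero_iff two_ne_zero |>.1 hi
  ext l
  simp only [zeroColumns, Set.mem_ofPred_eq, hβ, hammersteinParameter, Sum.elim_inr, mul_eq_zero]
  exact ⟨fun h => (h i).resolve_left hi, fun h _ => Or.inr h⟩

end Path

theorem sum_Icc_one_eq_sum_range (t : ℕ → ℝ) (N : ℕ) :
    ∑ k ∈ Finset.Icc 1 N, t k = ∑ n ∈ Finset.range N, t (n + 1) := by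
  rw [Finset.range_eq_Ico, Finset.sum_Ico_add']
  rfl

theorem isBigO_sum_dotProduct_self {ι : Type*} [Fintype ι] {φ : ℕ → ι → ℝ} {α : ℝ} (hα : 0 ≤ α)
    (hφ : ∀ l, WeightedSqSummable α fun n => φ (n + 1) l) :
    (fun N => ∑ k ∈ Finset.Icc 1 N, φ k ⬝ᵥ φ k) =O[atTop] fun N : ℕ => (N : ℝ) ^ α := by
  simp only [sum_Icc_one_eq_sum_range, dotProduct, ← pow_two]
  simp only [Finset.sum_comm (s := Finset.range _)]
  exact IsBigO.fun_sum fun l _ => (hφ l).isBigO_sum_sq hα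

variable {Ω : Type*} {mΩ : MeasurableSpace Ω} {P : Measure Ω}

theorem IsBoundedVarianceMDS.ae_isBigO_noiseScore [IsProbabilityMeasure P] {ℱ : Filtration ℕ mΩ}
    {D : ℕ → Ω → ℝ} (hD : IsBoundedVarianceMDS P ℱ fun n => D (n + 1)) {α : ℝ} (hα : 0 ≤ α)
    {ι : Type*} [Fintype ι]
    {φ : Ω → ℕ → ι → ℝ} (hφ : ∀ n l, Measurable[ℱ n] fun ω => φ ω (n + 1) l) :
    ∀ᵐ ω ∂P, (∀ l, WeightedSqSummable α fun n => φ ω (n + 1) l) →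
      noiseScore (φ ω) (D · ω) =O[atTop] fun N : ℕ => (N : ℝ) ^ (α / 2) := by
  filter_upwards [ae_all_iff.2 fun l => hD.ae_isBigO_sum_mul hα fun n => hφ n l] with ω hω hsum
  refine isBigO_pi.2 fun l => ?_
  simpa only [noiseScore, Finset.sum_apply, Pi.smul_apply, smul_eq_mul, sum_Icc_one_eq_sum_range,
    mul_comm] using hω l (hsum l)

end HammersteinRegression

section AlmostSure

open Asymptotics

variable {Ω : Type*} {mΩ : MeasurableSpace Ω} {P : Measure Ω} {s : ℕ} {g : Fin s → ℝ → ℝ}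
  {u : ℤ → Ω → ℝ} {w : ℕ → Ω → ℝ}

theorem IIDInput.exists_isExogenousIID {lo hi : ℝ} (h : IIDInput P g lo hi u w)
    (hg : ∀ j, Measurable (g j)) (hbasis : BasisIndependentOn g lo hi)
    (hu : ∀ n : ℕ, Measurable (u (n + 1))) (hw : ∀ n, Measurable (w (n + 2))) :
    ∃ μ, IsExogenousIID P μ (fun (n : ℕ) ω => u (n + 1) ω) (fun ω n => w (n + 2) ω) ∧
      (∀ j, MemLp (g j) 2 μ) ∧ IndependentModConst μ g := by
  obtain ⟨hiid, ⟨dens, hdens, -, -, hpos, hlaw⟩, hsq, hindep⟩ := h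
  have hshift : Measurable fun (x : ℕ → ℝ) n => x (n + 1) := by fun_prop
  have hexo : IsExogenousIID P (volume.withDensity fun x => ENNReal.ofReal (dens x))
      (fun (n : ℕ) ω => u (n + 1) ω) (fun ω n => w (n + 2) ω) :=
    { measurable_input := hu
      measurable_exogenous := measurable_pi_lambda _ hw
      map_eq := fun n => hlaw _ (by lia)
      independent := hiid
      indepFun := hindep.comp measurable_id hshift }
  refine ⟨_, hexo, fun j => ?_,
    hbasis.independentModConst (restrict_absolutelyContinuous_withDensity hdens
      measurableSet_Icc hpos)⟩
  rw [memLp_two_iff_integrable_sq (hg j).aestronglyMeasurable, ← (hexo.measurePreserving 0).map_eq,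
    integrable_map_measure ((hg j).pow_const 2).aestronglyMeasurable (hu 0).aemeasurable]
  exact (hsq j _ (by lia)).1

theorem PersistentNoise.ae_exists_hasTimeAverageGE (h : PersistentNoise P w) (m : ℕ) :
    ∀ᵐ ω ∂P, ∃ κ, 0 < κ ∧ HasTimeAverageGE (fun n => w (n + (m + 1)) ω ^ 2) κ := by
  filter_upwards [h] with ω ⟨κ, hκ, hN⟩
  have hone : HasTimeAverageGE (fun n => w (n + 1) ω ^ 2) κ := fun r hr => by
    filter_upwards [hN] with N hN
    rw [← sum_Icc_one_eq_sum_range fun k => w k ω ^ 2]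
    exact (mul_le_mul_of_nonneg_right hr.le N.cast_nonneg).trans hN
  exact ⟨κ, hκ, by simpa only [add_assoc] using hone.nat_add m⟩

variable [IsProbabilityMeasure P] {μ : Measure ℝ} {ℱ : Filtration ℕ mΩ}

theorem IsExogenousIID.ae_weightedSqSummable
    (h : IsExogenousIID P μ (fun (n : ℕ) ω => u (n + 1) ω) (fun ω n => w (n + 2) ω))
    {f : ℝ → ℝ} (hf : Measurable f) (hf2 : MemLp f 2 μ) {α : ℝ} (hα : 1 < α) :
    ∀ᵐ ω ∂P, WeightedSqSummable α fun n : ℕ => f (u n ω) := by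
  filter_upwards [(h.isBoundedVarianceMDS hf hf2).ae_weightedSqSummable hα] with ω hω
  refine (weightedSqSummable_nat_add_iff (v := fun n : ℕ => f (u n ω)) (by linarith) 1).1 ?_
  simpa using hω.add (weightedSqSummable_const hα μ[f])

variable {p q : ℕ} {a : Fin p → ℝ} {b : Fin q → ℝ} {d : Fin s → ℝ} {y : ℤ → Ω → ℝ}

theorem ae_persistentlyExciting
    (hsystem : ∀ ω, IsHammersteinPath a b d g (y · ω) (u · ω) (w · ω))
    (hnoise : IsBoundedVarianceMDS P (shiftFiltration ℱ 1) fun n => w (n + 2))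
    (hinput : IsExogenousIID P μ (fun (n : ℕ) ω => u (n + 1) ω) (fun ω n => w (n + 2) ω))
    (hg : ∀ j, Measurable (g j)) (hg2 : ∀ j, MemLp (g j) 2 μ) (hind : IndependentModConst μ g)
    (hnondeg : PersistentNoise P w ∨ MinimalSystem a b d) :
    ∀ᵐ ω ∂P, PersistentlyExciting (hammersteinRegressor p q g (y · ω) (u · ω)) := by
  have hlow : ∀ᵐ ω ∂P, ∃ κ, 0 ≤ κ ∧ (0 < κ ∨ MinimalSystem a b d) ∧
      HasTimeAverageGE (fun n => w (n + 2) ω ^ 2) κ := by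
    rcases hnondeg with hpers | hmin
    · exact (hpers.ae_exists_hasTimeAverageGE 1).mono fun ω ⟨κ, hκ, hav⟩ => ⟨κ, hκ.le, .inl hκ, hav⟩
    · refine ae_of_all _ fun ω => ⟨0, le_rfl, .inr hmin, fun r hr => .of_forall fun N => ?_⟩
      exact (mul_nonpos_of_nonpos_of_nonneg hr.le N.cast_nonneg).trans
        (Finset.sum_nonneg fun _ _ => sq_nonneg _)
  have := hinput.isProbabilityMeasure
  filter_upwards [hlow, hinput.ae_forall_isWhite hnoise hg hg2] with ω ⟨κ, hκ, hκ', hav⟩ hwhite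
  refine (hsystem ω).persistentlyExciting hκ (hind.posDef_covarianceMatrix hg2)
    (Sum.elim 0 fun j => μ[g j]) ?_ hκ'
  convert hwhite κ hav using 1
  funext c n
  rcases c with _ | j
  · have htime : ((n : ℤ) + 1 + 1).toNat = n + 2 := by lia
    simp [drivingSignal, innovationSignal, htime]
  · rfl

theorem proposition2_general (hg : ∀ j, Measurable (g j))
    (hadapted : ∀ k : ℕ, 1 ≤ k → ∀ j : ℤ, j ≤ k → Measurable[ℱ k] (y j) ∧ Measurable[ℱ k] (u j))
    (hsystem : ∀ ω, IsHammersteinPath a b d g (y · ω) (u · ω) (w · ω))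
    (hnoise : IsBoundedVarianceMDS P (shiftFiltration ℱ 1) fun n => w (n + 2))
    (hstable : ∀ z : ℂ, ‖z‖ ≤ 1 → Polynomial.aeval z (arPoly a) ≠ 0)
    (hinput : IsExogenousIID P μ (fun (n : ℕ) ω => u (n + 1) ω) (fun ω n => w (n + 2) ω))
    (hg2 : ∀ j, MemLp (g j) 2 μ) (hind : IndependentModConst μ g)
    (hnondeg : PersistentNoise P w ∨ MinimalSystem a b d)
    {lam : ℕ → ℝ} {η : ℝ} (hη : 0 < η) (hlam : ∀ᶠ N : ℕ in atTop, (N : ℝ) ^ η ≤ lam N)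
    (hlam' : lam =o[atTop] fun N : ℕ => (N : ℝ)) :
    ∀ᵐ ω ∂P, ∀ᶠ N in atTop,
      SparseAlgorithmWellDefined (hammersteinRegressor p q g (y · ω) (u · ω))
        (nextOutput (y · ω)) lam N ∧
      ∀ β, IsSparseEstimate (hammersteinRegressor p q g (y · ω) (u · ω))
        (nextOutput (y · ω)) lam N β → ∀ l, β l = 0 ↔ hammersteinParameter a b d l = 0 := by
  obtain ⟨δ, hδ, hδη⟩ : ∃ δ ∈ Set.Ioo (0 : ℝ) (1 / 6), 4 * δ < η :=
    ⟨min (η / 5) (1 / 8), ⟨by positivity, (min_le_right _ _).trans_lt (by norm_num)⟩,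
      by linarith [min_le_left (η / 5) (1 / 8)]⟩
  have hα : 1 < 1 + 2 * δ := by linarith [hδ.1]
  have hα0 : 0 ≤ 1 + 2 * δ := zero_le_one.trans hα.le
  have hφ : ∀ n l, Measurable[shiftFiltration ℱ 1 n] fun ω =>
      hammersteinRegressor p q g (y · ω) (u · ω) (n + 1) l := by
    rintro n (i | ⟨i, j⟩)
    · exact (hadapted (n + 1) (by lia) _ (by lia)).1
    · exact (hg j).comp (hadapted (n + 1) (by lia) _ (by lia)).2
  have hlam_pos : ∀ᶠ N in atTop, 0 < lam N := by
    filter_upwards [hlam, eventually_gt_atTop 0] with N hN hN0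
    exact (Real.rpow_pos_of_pos (Nat.cast_pos.2 hN0) η).trans_le hN
  have hlamO : (fun N : ℕ => (N : ℝ) ^ η) =O[atTop] lam := .of_norm_eventuallyLE <| by
    filter_upwards [hlam] with N hN
    rwa [Real.norm_of_nonneg (by positivity)]
  filter_upwards [ae_persistentlyExciting hsystem hnoise hinput hg hg2 hind hnondeg,
    hnoise.ae_isBigO_noiseScore (D := fun n => w (n + 1)) hα0 hφ,
    hnoise.ae_weightedSqSummable hα,
    ae_all_iff.2 fun j => hinput.ae_weightedSqSummable (hg j) (hg2 j) hα]
    with ω hexc hscore hw hu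
  have hsum := fun l => (weightedSqSummable_nat_add_iff hα0 1).2
    ((hsystem ω).weightedSqSummable_regressor hstable hα0
      ((weightedSqSummable_nat_add_iff (v := (w · ω)) hα0 2).1 hw) hu l)
  refine hexc.eventually_wellDefined_and_support_eq hδ
    (fun k hk => (hsystem ω).nextOutput_eq hk) ?_ (isBigO_sum_dotProduct_self hα0 hsum) hlam_pos
    ((isLittleO_natCast_rpow_of_lt hδη).trans_isBigO hlamO) hlam'
  convert hscore hsum using 3
  ring

end AlmostSure

theorem proposition2 {Ω : Type*} {mΩ : MeasurableSpace Ω} (P : Measure Ω) [IsProbabilityMeasure P]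
    {p q s : ℕ} (a : Fin p → ℝ) (b : Fin q → ℝ) (d : Fin s → ℝ)
    (g : Fin s → ℝ → ℝ) (hg : ∀ j, Measurable (g j))
    (lo hi : ℝ) (hlohi : lo < hi)
    (y u : ℤ → Ω → ℝ) (w : ℕ → Ω → ℝ) (ℱ : Filtration ℕ mΩ)
    (hadapted : ∀ k : ℕ, 1 ≤ k → ∀ j : ℤ, j ≤ k → Measurable[ℱ k] (y j) ∧ Measurable[ℱ k] (u j))
    (hsystem : ∀ ω, IsHammersteinPath a b d g (fun j => y j ω) (fun j => u j ω) (fun k => w k ω))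
    (hnoise : MartingaleDifferenceNoise P ℱ w)
    (hstable : StableARX a b)
    (hbasis : BasisIndependentOn g lo hi)
    (hinput : IIDInput P g lo hi u w)
    (hnondeg : PersistentNoise P w ∨ MinimalSystem a b d)
    (ε : ℝ) (hε : ε ∈ Set.Ioo (0 : ℝ) (1 / 2)) :
    ∀ᵐ ω ∂P, ∃ N₀ : ℕ, ∀ N : ℕ, N₀ ≤ N →
      SparseAlgorithmWellDefined
          (hammersteinRegressor p q g (fun j => y j ω) (fun j => u j ω))
          (nextOutput fun j => y j ω) (fun n => (n : ℝ) ^ (1 / 2 + ε)) N ∧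
      ∀ β : Fin p ⊕ (Fin q × Fin s) → ℝ,
        IsSparseEstimate
          (hammersteinRegressor p q g (fun j => y j ω) (fun j => u j ω))
          (nextOutput fun j => y j ω) (fun n => (n : ℝ) ^ (1 / 2 + ε)) N β →
        zeroColumns β = {l | d l = 0} := by
  obtain ⟨μ, hexo, hg2, hind⟩ := hinput.exists_isExogenousIID hg hbasis
    (fun n => (hadapted (n + 1) (by lia) _ (by lia)).2.mono (ℱ.le _) le_rfl)
    fun n => (hnoise.1 (n + 2) (by lia)).mono (ℱ.le _) le_rfl
  have hlam : (fun N : ℕ => (N : ℝ) ^ (1 / 2 + ε)) =o[atTop] fun N : ℕ => (N : ℝ) := by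
    simpa only [Real.rpow_one] using isLittleO_natCast_rpow_of_lt (α' := 1) (by linarith [hε.2])
  exact (proposition2_general hg hadapted hsystem hnoise.isBoundedVarianceMDS hstable.1 hexo hg2
    hind hnondeg (by linarith [hε.1]) (.of_forall fun _ => le_rfl) hlam).mono fun ω hω =>
      eventually_atTop.1 <| hω.mono fun N hN => ⟨hN.1, fun β hβ =>
        zeroColumns_eq_of_forall_eq_zero_iff hstable.2 (hN.2 β hβ)⟩
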